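/- Conventions. All monoidal categories and functors are strict. A CD-category is a symmetric monoidal category in which every object $X$ carries a commutative comonoid structure (copy $X\to X\otimes X$, delete $X\to I$) compatible with the monoidal structure; a CD-functor is a symmetric monoidal functor preserving copy and delete. $\mathbf{CDCat}$ is the category of CD-categories and CD-functors. An ordered DAG $\mathcal G$ is a finite directed graph with a total order on its vertex set $V_{\mathcal G}$ such that $v\to w$ implies $v<w$; $\mathrm{Pa}(v)$ is the set of parents of $v$. $\mathbf{ODAG}$ is the category of ordered DAGs, whose morphisms $\alpha\colon\mathcal G\to\mathcal G'$ are the monotone maps $V_{\mathcal G}\to V_{\mathcal G'}$ such that $v\to w$ implies $\alpha(v)=\alpha(w)$ or $\alpha(v)\to\alpha(w)$. A set of vertices used as an object denotes the tensor product of its elements in increasing order. $\mathsf{CDSyn}_{\mathcal G}$ is the free CD-category on the signature with generating objects the vertices of $\mathcal G$ and one generating morphism $g_v\colon \mathrm{Pa}(v)\to v$ for each vertex $v$. For $S\subseteq V_{\mathcal G}$ let $\mathrm{In}(S)=\left(\bigcup_{v\in S}\mathrm{Pa}(v)\right)\setminus S$. The copy-composition $\mathrm{cc}(S)\colon \mathrm{In}(S)\to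 S$ of $\{g_v\mid v\in S\}$ is defined by $\mathrm{cc}(\emptyset)=\mathrm{id}_I$ and, for $S\neq\emptyset$ with largest element $m$ and $S'=S\setminus\{m\}$, by applying $\mathrm{cc}(S')$ to copies of the wires in $\mathrm{In}(S')$, applying $g_m$ to copies of the wires labelled by $\mathrm{Pa}(m)$ among the outputs $S'$ of $\mathrm{cc}(S')$ and the inputs $\mathrm{In}(S)$, deleting the copies that are not used, and outputting $S'$ together with $m$ (wires being permuted as needed). Theorem. There is a contravariant functor $\mathsf{CDSyn}\colon\mathbf{ODAG}\to\mathbf{CDCat}$ that sends an ordered DAG $\mathcal G$ to $\mathsf{CDSyn}_{\mathcal G}$ and a morphism $\alpha\colon\mathcal G\to\mathcal G'$ to the unique CD-functor $\mathsf{CDSyn}_{\mathcal G'}\to\mathsf{CDSyn}_{\mathcal G}$ which maps every vertex $v$ of $\mathcal G'$ to the tensor product of $\alpha^{-1}(v)$ in increasing order, and maps every generating morphism $g_v\colon\mathrm{Pa}(v)\to v$ to the morphism $\alpha^{-1}(\mathrm{Pa}(v))\to\alpha^{-1}(v)$ that deletes $\alpha^{-1}(\mathrm{Pa}(v))\setminus\mathrm{In}(\alpha^{-1}(v))$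 and applies $\mathrm{cc}(\alpha^{-1}(v))$ to the remaining wires $\mathrm{In}(\alpha^{-1}(v))$. -/

import Mathlib

open CategoryTheory MonoidalCategory Opposite
open scoped ComonObj

universe v₁ v₂ v₃ u₁ u₂ u₃ v u w

/-! ### Strict CD-categories and CD-functors -/

/-- A monoidal category is strict if associators and unitors are identities. As source and target
of these isomorphisms are only propositionally equal, identities are written `eqToHom`. -/
class IsStrictMonoidal (C : Type u) [Category.{v} C] [MonoidalCategory C] : Prop where
  tensor_assoc : ∀ X Y Z : C, (X ⊗ Y) ⊗ Z = X ⊗ (Y ⊗ Z)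
  unit_tensor : ∀ X : C, 𝟙_ C ⊗ X = X
  tensor_unit : ∀ X : C, X ⊗ 𝟙_ C = X
  associator_hom : ∀ X Y Z : C, (α_ X Y Z).hom = eqToHom (tensor_assoc X Y Z)
  leftUnitor_hom : ∀ X : C, (λ_ X).hom = eqToHom (unit_tensor X)
  rightUnitor_hom : ∀ X : C, (ρ_ X).hom = eqToHom (tensor_unit X)

/-- A CD-functor between (strict) CD-categories: a strict symmetric monoidal functor
preserving copy and delete. -/
structure CDFunctor (C : Type u₁) [Category.{v₁} C] [MonoidalCategory C] [CopyDiscardCategory C]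
    (D : Type u₂) [Category.{v₂} D] [MonoidalCategory D] [CopyDiscardCategory D]
    extends C ⥤ D where
  obj_unit : obj (𝟙_ C) = 𝟙_ D
  obj_tensor : ∀ X Y : C, obj (X ⊗ Y) = obj X ⊗ obj Y
  map_tensor : ∀ {X X' Y Y' : C} (f : X ⟶ X') (g : Y ⟶ Y'),
    map (f ⊗ₘ g) =
      eqToHom (obj_tensor X Y) ≫ (map f ⊗ₘ map g) ≫ eqToHom (obj_tensor X' Y').symm
  map_braiding : ∀ X Y : C,
    map (β_ X Y).hom =
      eqToHom (obj_tensor X Y) ≫ (β_ (obj X) (obj Y)).hom ≫ eqToHom (obj_tensor Y X).symm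
  map_copy : ∀ X : C, map Δ[X] = Δ[obj X] ≫ eqToHom (obj_tensor X X).symm
  map_del : ∀ X : C, map ε[X] = ε[obj X] ≫ eqToHom obj_unit.symm

namespace CDFunctor

section

variable {C : Type u₁} [Category.{v₁} C] [MonoidalCategory C] [CopyDiscardCategory C]
  {D : Type u₂} [Category.{v₂} D] [MonoidalCategory D] [CopyDiscardCategory D]
  {E : Type u₃} [Category.{v₃} E] [MonoidalCategory E] [CopyDiscardCategory E]

theorem ext' {F G : CDFunctor C D} (h : F.toFunctor = G.toFunctor) : F = G := by
  cases F; cases G; cases h; rfl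

/-- The identity CD-functor. -/
def id (C : Type u₁) [Category.{v₁} C] [MonoidalCategory C] [CopyDiscardCategory C] :
    CDFunctor C C where
  toFunctor := 𝟭 C
  obj_unit := rfl
  obj_tensor _ _ := rfl
  map_tensor _ _ := by simp
  map_braiding _ _ := by simp
  map_copy _ := by simp
  map_del _ := by simp

/-- Composition of CD-functors. -/
def comp (F : CDFunctor C D) (G : CDFunctor D E) : CDFunctor C E where
  toFunctor := F.toFunctor ⋙ G.toFunctor
  obj_unit := (congrArg G.obj F.obj_unit).trans G.obj_unit
  obj_tensor X Y := (congrArg G.obj (F.obj_tensor X Y)).trans (G.obj_tensor _ _)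
  map_tensor f g := by
    simp [F.map_tensor, G.map_tensor, eqToHom_map]
  map_braiding X Y := by
    simp [F.map_braiding, G.map_braiding, eqToHom_map]
  map_copy X := by
    simp [F.map_copy, G.map_copy, eqToHom_map]
  map_del X := by
    simp [F.map_del, G.map_del, eqToHom_map]

end

end CDFunctor

/-- CD-categories: symmetric strict monoidal categories in which every object carries a
commutative comonoid structure (copy and delete) compatible with the monoidal structure. -/
structure CDCat : Type (max (u + 1) (v + 1)) where
  carrier : Type u
  [category : Category.{v} carrier]
  [monoidal : MonoidalCategory carrier]
  [copyDiscard : CopyDiscardCategory carrier]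
  [strict : IsStrictMonoidal carrier]

attribute [instance] CDCat.category CDCat.monoidal CDCat.copyDiscard CDCat.strict

/-- The category of CD-categories and CD-functors. -/
instance CDCat.largeCategory : Category CDCat.{v, u} where
  Hom C D := CDFunctor C.carrier D.carrier
  id C := CDFunctor.id C.carrier
  comp F G := CDFunctor.comp F G
  id_comp _ := CDFunctor.ext' rfl
  comp_id _ := CDFunctor.ext' rfl
  assoc _ _ _ := CDFunctor.ext' rfl

/-! ### Free CD-categories -/

/-- A monoidal signature: generating objects, and generating morphisms typed by finite lists of
generating objects. -/
structure MonoidalSignature : Type (max (u + 1) (w + 1)) where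
  Obj : Type u
  Gen : Type w
  dom : Gen → List Obj
  cod : Gen → List Obj

/-- Formal string diagrams over a signature. -/
inductive CDTerm (σ : MonoidalSignature.{u, w}) : List σ.Obj → List σ.Obj → Type (max u w)
  | gen (g : σ.Gen) : CDTerm σ (σ.dom g) (σ.cod g)
  | id (X : List σ.Obj) : CDTerm σ X X
  | comp {X Y Z : List σ.Obj} (f : CDTerm σ X Y) (g : CDTerm σ Y Z) : CDTerm σ X Z
  | tensor {X Y X' Y' : List σ.Obj} (f : CDTerm σ X Y) (g : CDTerm σ X' Y') :
      CDTerm σ (X ++ X') (Y ++ Y')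
  | braid (X Y : List σ.Obj) : CDTerm σ (X ++ Y) (Y ++ X)
  | copy (X : List σ.Obj) : CDTerm σ X (X ++ X)
  | del (X : List σ.Obj) : CDTerm σ X []

namespace CDTerm

variable {σ : MonoidalSignature.{u, w}}

/-- The identity of `X`, regarded as a morphism to an object equal to `X`. -/
def castId {X Y : List σ.Obj} (h : X = Y) : CDTerm σ X Y := h ▸ CDTerm.id X

/-- The least congruence containing the laws of strict symmetric monoidal categories and the laws
of the copy and delete maps. Copy and delete on a list of generating objects are determined by
those on its entries through the laws `copy_append`, `copy_nil`, `del_append` and `del_nil`. -/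
inductive Rel : ∀ {X Y : List σ.Obj}, CDTerm σ X Y → CDTerm σ X Y → Prop
  | refl {X Y} (f : CDTerm σ X Y) : Rel f f
  | symm {X Y} {f g : CDTerm σ X Y} : Rel f g → Rel g f
  | trans {X Y} {f g h : CDTerm σ X Y} : Rel f g → Rel g h → Rel f h
  | comp_congr {X Y Z} {f f' : CDTerm σ X Y} {g g' : CDTerm σ Y Z} :
      Rel f f' → Rel g g' → Rel (f.comp g) (f'.comp g')
  | tensor_congr {X Y X' Y'} {f f' : CDTerm σ X Y} {g g' : CDTerm σ X' Y'} :
      Rel f f' → Rel g g' → Rel (f.tensor g) (f'.tensor g')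
  -- category laws
  | id_comp {X Y} (f : CDTerm σ X Y) : Rel ((CDTerm.id X).comp f) f
  | comp_id {X Y} (f : CDTerm σ X Y) : Rel (f.comp (CDTerm.id Y)) f
  | assoc {X Y Z W} (f : CDTerm σ X Y) (g : CDTerm σ Y Z) (h : CDTerm σ Z W) :
      Rel ((f.comp g).comp h) (f.comp (g.comp h))
  -- functoriality of the tensor
  | id_tensor_id (X Y : List σ.Obj) :
      Rel ((CDTerm.id X).tensor (CDTerm.id Y)) (CDTerm.id (X ++ Y))
  | tensor_comp {X Y Z X' Y' Z'} (f : CDTerm σ X Y) (f' : CDTerm σ X' Y')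
      (g : CDTerm σ Y Z) (g' : CDTerm σ Y' Z') :
      Rel ((f.tensor f').comp (g.tensor g')) ((f.comp g).tensor (f'.comp g'))
  -- strict associativity and unitality of the tensor
  | tensor_assoc {X₁ X₂ X₃ Y₁ Y₂ Y₃} (f₁ : CDTerm σ X₁ Y₁) (f₂ : CDTerm σ X₂ Y₂)
      (f₃ : CDTerm σ X₃ Y₃) :
      Rel (((f₁.tensor f₂).tensor f₃).comp (castId (List.append_assoc Y₁ Y₂ Y₃)))
        ((castId (List.append_assoc X₁ X₂ X₃)).comp (f₁.tensor (f₂.tensor f₃)))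
  | unit_tensor {X Y} (f : CDTerm σ X Y) :
      Rel (((CDTerm.id []).tensor f).comp (castId (List.nil_append Y)))
        ((castId (List.nil_append X)).comp f)
  | tensor_unit {X Y} (f : CDTerm σ X Y) :
      Rel ((f.tensor (CDTerm.id [])).comp (castId (List.append_nil Y)))
        ((castId (List.append_nil X)).comp f)
  -- symmetry
  | braid_natural {X Y X' Y'} (f : CDTerm σ X Y) (f' : CDTerm σ X' Y') :
      Rel ((f.tensor f').comp (braid Y Y')) ((braid X X').comp (f'.tensor f))
  | braid_braid (X Y : List σ.Obj) : Rel ((braid X Y).comp (braid Y X)) (CDTerm.id (X ++ Y))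
  | hexagon (X Y Z : List σ.Obj) :
      Rel ((castId (List.append_assoc X Y Z)).comp
          ((braid X (Y ++ Z)).comp (castId (List.append_assoc Y Z X))))
        (((braid X Y).tensor (CDTerm.id Z)).comp
          ((castId (List.append_assoc Y X Z)).comp ((CDTerm.id Y).tensor (braid X Z))))
  -- commutative comonoids
  | copy_comm (X : List σ.Obj) : Rel ((copy X).comp (braid X X)) (copy X)
  | copy_assoc (X : List σ.Obj) :
      Rel ((copy X).comp ((CDTerm.id X).tensor (copy X)))
        ((copy X).comp (((copy X).tensor (CDTerm.id X)).comp (castId (List.append_assoc X X X))))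
  | copy_del_left (X : List σ.Obj) :
      Rel ((copy X).comp (((del X).tensor (CDTerm.id X)).comp (castId (List.nil_append X))))
        (CDTerm.id X)
  | copy_del_right (X : List σ.Obj) :
      Rel ((copy X).comp (((CDTerm.id X).tensor (del X)).comp (castId (List.append_nil X))))
        (CDTerm.id X)
  -- compatibility of copy and delete with the monoidal structure
  | copy_append (X Y : List σ.Obj) :
      Rel (copy (X ++ Y))
        (((copy X).tensor (copy Y)).comp
          ((castId (by simp : (X ++ X) ++ (Y ++ Y) = X ++ ((X ++ Y) ++ Y))).comp
            (((CDTerm.id X).tensor ((braid X Y).tensor (CDTerm.id Y))).comp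
              (castId (by simp : X ++ ((Y ++ X) ++ Y) = (X ++ Y) ++ (X ++ Y))))))
  | copy_nil : Rel (copy []) (castId (List.nil_append []).symm)
  | del_append (X Y : List σ.Obj) :
      Rel (del (X ++ Y)) (((del X).tensor (del Y)).comp (castId (List.nil_append [])))
  | del_nil : Rel (del []) (CDTerm.id [])

/-- Formal string diagrams up to the laws of CD-categories. -/
def setoid (X Y : List σ.Obj) : Setoid (CDTerm σ X Y) :=
  ⟨Rel, ⟨Rel.refl, Rel.symm, Rel.trans⟩⟩

end CDTerm

/-- Objects of the free CD-category on a signature: finite lists of generating objects. -/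
structure FreeCD (σ : MonoidalSignature.{u, w}) where
  word : List σ.Obj

namespace FreeCD

variable {σ : MonoidalSignature.{u, w}}

open CDTerm

instance category : Category.{max u w} (FreeCD σ) where
  Hom X Y := Quotient (CDTerm.setoid X.word Y.word)
  id X := Quotient.mk _ (CDTerm.id X.word)
  comp := Quotient.map₂ CDTerm.comp (fun _ _ hf _ _ hg => Rel.comp_congr hf hg)
  id_comp := by
    rintro X Y ⟨f⟩
    exact Quotient.sound (Rel.id_comp f)
  comp_id := by
    rintro X Y ⟨f⟩
    exact Quotient.sound (Rel.comp_id f)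
  assoc := by
    rintro W X Y Z ⟨f⟩ ⟨g⟩ ⟨h⟩
    exact Quotient.sound (Rel.assoc f g h)

/-- The morphism represented by a formal string diagram. -/
def homMk {X Y : List σ.Obj} (f : CDTerm σ X Y) : (⟨X⟩ : FreeCD σ) ⟶ ⟨Y⟩ :=
  Quotient.mk (CDTerm.setoid X Y) f

theorem homMk_comp {X Y Z : List σ.Obj} (f : CDTerm σ X Y) (g : CDTerm σ Y Z) :
    homMk (f.comp g) = homMk f ≫ homMk g := rfl

theorem homMk_id (X : List σ.Obj) : homMk (CDTerm.id X) = 𝟙 (⟨X⟩ : FreeCD σ) := rfl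

theorem homMk_castId {X Y : List σ.Obj} (h : X = Y) :
    homMk (castId h) = eqToHom (congrArg FreeCD.mk h) := by
  subst h; rfl

theorem homMk_sound {X Y : List σ.Obj} {f g : CDTerm σ X Y} (h : Rel f g) :
    homMk f = homMk g :=
  Quotient.sound h

/-- The monoidal product: concatenation of lists, parallel composition of diagrams. -/
instance monoidalCategoryStruct : MonoidalCategoryStruct (FreeCD σ) where
  tensorObj X Y := ⟨X.word ++ Y.word⟩
  tensorUnit := ⟨[]⟩
  tensorHom := Quotient.map₂ CDTerm.tensor (fun _ _ hf _ _ hg => Rel.tensor_congr hf hg)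
  whiskerLeft X _ _ f :=
    Quotient.map₂ CDTerm.tensor (fun _ _ hf _ _ hg => Rel.tensor_congr hf hg) (𝟙 X) f
  whiskerRight f Y :=
    Quotient.map₂ CDTerm.tensor (fun _ _ hf _ _ hg => Rel.tensor_congr hf hg) f (𝟙 Y)
  associator X Y Z := eqToIso (congrArg FreeCD.mk (List.append_assoc X.word Y.word Z.word))
  leftUnitor X := eqToIso (congrArg FreeCD.mk (List.nil_append X.word))
  rightUnitor X := eqToIso (congrArg FreeCD.mk (List.append_nil X.word))

theorem homMk_tensor {X Y X' Y' : List σ.Obj} (f : CDTerm σ X Y) (g : CDTerm σ X' Y') :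
    homMk (f.tensor g) = homMk f ⊗ₘ homMk g := rfl

theorem word_tensor (X Y : FreeCD σ) : (X ⊗ Y).word = X.word ++ Y.word := rfl

theorem associator_def (X Y Z : FreeCD σ) : (α_ X Y Z).hom =
    eqToHom (congrArg FreeCD.mk (List.append_assoc X.word Y.word Z.word)) := rfl

theorem leftUnitor_def (X : FreeCD σ) :
    (λ_ X).hom = eqToHom (congrArg FreeCD.mk (List.nil_append X.word)) := rfl

theorem rightUnitor_def (X : FreeCD σ) :
    (ρ_ X).hom = eqToHom (congrArg FreeCD.mk (List.append_nil X.word)) := rfl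

theorem tensor_eqToHom {X Y Z W : FreeCD σ} (h : X = Y) (k : Z = W) :
    eqToHom h ⊗ₘ eqToHom k = eqToHom (congrArg₂ (· ⊗ ·) h k) := by
  subst h; subst k
  exact homMk_sound (Rel.id_tensor_id X.word Z.word)

instance monoidalCategory : MonoidalCategory (FreeCD σ) :=
  MonoidalCategory.ofTensorHom
    (id_tensorHom_id := fun X Y => homMk_sound (Rel.id_tensor_id X.word Y.word))
    (tensorHom_comp_tensorHom := by
      rintro _ _ _ _ _ _ ⟨f₁⟩ ⟨f₂⟩ ⟨g₁⟩ ⟨g₂⟩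
      exact homMk_sound (Rel.tensor_comp f₁ f₂ g₁ g₂))
    (associator_naturality := by
      rintro _ _ _ _ _ _ ⟨f₁⟩ ⟨f₂⟩ ⟨f₃⟩
      have := homMk_sound (Rel.tensor_assoc f₁ f₂ f₃)
      rw [homMk_comp, homMk_comp, homMk_castId, homMk_castId] at this
      exact this)
    (leftUnitor_naturality := by
      rintro _ _ ⟨f⟩
      have := homMk_sound (Rel.unit_tensor f)
      rw [homMk_comp, homMk_comp, homMk_castId, homMk_castId] at this
      exact this)
    (rightUnitor_naturality := by
      rintro _ _ ⟨f⟩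
      have := homMk_sound (Rel.tensor_unit f)
      rw [homMk_comp, homMk_comp, homMk_castId, homMk_castId] at this
      exact this)
    (pentagon := by
      intro W X Y Z
      simp only [associator_def]
      rw [← eqToHom_refl Z rfl, ← eqToHom_refl W rfl]
      erw [tensor_eqToHom, tensor_eqToHom, eqToHom_trans, eqToHom_trans, eqToHom_trans])
    (triangle := by
      intro X Y
      simp only [associator_def, leftUnitor_def, rightUnitor_def]
      rw [← eqToHom_refl X rfl, ← eqToHom_refl Y rfl]
      erw [tensor_eqToHom, tensor_eqToHom, eqToHom_trans])

instance strict : IsStrictMonoidal (FreeCD σ) where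
  tensor_assoc X Y Z := congrArg FreeCD.mk (List.append_assoc X.word Y.word Z.word)
  unit_tensor X := congrArg FreeCD.mk (List.nil_append X.word)
  tensor_unit X := congrArg FreeCD.mk (List.append_nil X.word)
  associator_hom _ _ _ := rfl
  leftUnitor_hom _ := rfl
  rightUnitor_hom _ := rfl

/-- The symmetry. -/
def braidIso (X Y : FreeCD σ) : X ⊗ Y ≅ Y ⊗ X where
  hom := homMk (CDTerm.braid X.word Y.word)
  inv := homMk (CDTerm.braid Y.word X.word)
  hom_inv_id := homMk_sound (Rel.braid_braid X.word Y.word)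
  inv_hom_id := homMk_sound (Rel.braid_braid Y.word X.word)

theorem braidIso_hexagon (X Y Z : FreeCD σ) :
    (α_ X Y Z).hom ≫ (braidIso X (Y ⊗ Z)).hom ≫ (α_ Y Z X).hom =
      ((braidIso X Y).hom ▷ Z) ≫ (α_ Y X Z).hom ≫ (Y ◁ (braidIso X Z).hom) := by
  have := homMk_sound (Rel.hexagon X.word Y.word Z.word)
  simp only [homMk_comp, homMk_castId] at this
  exact this

instance symmetricCategory : SymmetricCategory (FreeCD σ) where
  braiding := braidIso
  braiding_naturality_right := by
    rintro X _ _ ⟨f⟩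
    exact homMk_sound (Rel.braid_natural (CDTerm.id X.word) f)
  braiding_naturality_left := by
    rintro _ _ ⟨f⟩ Z
    exact homMk_sound (Rel.braid_natural f (CDTerm.id Z.word))
  hexagon_forward := braidIso_hexagon
  hexagon_reverse X Y Z := by
    have h : (α_ Z X Y ≪≫ braidIso Z (X ⊗ Y) ≪≫ α_ X Y Z) =
        (whiskerRightIso (braidIso Z X) Y ≪≫ α_ X Z Y ≪≫ whiskerLeftIso X (braidIso Z Y)) :=
      Iso.ext (braidIso_hexagon Z X Y)
    have h' := congrArg Iso.inv h
    simp only [Iso.trans_inv, Category.assoc] at h'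
    exact h'
  symmetry X Y := homMk_sound (Rel.braid_braid X.word Y.word)

instance comonObj (X : FreeCD σ) : ComonObj X where
  comul := homMk (CDTerm.copy X.word)
  counit := homMk (CDTerm.del X.word)
  counit_comul := by
    rw [← cancel_mono (λ_ X).hom, Iso.inv_hom_id, Category.assoc]
    have := homMk_sound (Rel.copy_del_left X.word)
    simp only [homMk_comp, homMk_castId] at this
    exact this
  comul_counit := by
    rw [← cancel_mono (ρ_ X).hom, Iso.inv_hom_id, Category.assoc]
    have := homMk_sound (Rel.copy_del_right X.word)
    simp only [homMk_comp, homMk_castId] at this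
    exact this
  comul_assoc := by
    have := homMk_sound (Rel.copy_assoc X.word)
    simp only [homMk_comp, homMk_castId] at this
    exact this

instance copyDiscardCategory : CopyDiscardCategory (FreeCD σ) where
  isCommComonObj X := ⟨homMk_sound (Rel.copy_comm X.word)⟩
  copy_tensor X Y := by
    have := homMk_sound (Rel.copy_append X.word Y.word)
    simp only [homMk_comp, homMk_castId] at this
    have inv_def : ∀ A B C : FreeCD σ, (α_ A B C).inv =
        eqToHom (congrArg FreeCD.mk (List.append_assoc A.word B.word C.word)).symm :=
      fun _ _ _ => rfl
    simp only [tensorμ, inv_def, associator_def, whiskerLeft_eqToHom, eqToHom_trans,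
      eqToHom_trans_assoc]
    exact this
  discard_tensor X Y := by
    have := homMk_sound (Rel.del_append X.word Y.word)
    simp only [homMk_comp, homMk_castId] at this
    exact this
  copy_unit := by
    have := homMk_sound (Rel.copy_nil (σ := σ))
    simp only [homMk_castId] at this
    exact this
  discard_unit := homMk_sound Rel.del_nil

/-- The generating morphism `g` in the free CD-category. -/
def gen (g : σ.Gen) : (⟨σ.dom g⟩ : FreeCD σ) ⟶ ⟨σ.cod g⟩ := homMk (CDTerm.gen g)

open Classical in
/-- The marginalization of a list of generating objects to (the first occurrence of) one of its
entries `a`: all other wires are deleted. -/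
noncomputable def proj : (X : List σ.Obj) → (a : σ.Obj) → a ∈ X →
    ((⟨X⟩ : FreeCD σ) ⟶ ⟨[a]⟩)
  | [], _, h => absurd h List.not_mem_nil
  | x :: X, a, h =>
    if e : a = x then
      eqToHom (by rfl : (⟨x :: X⟩ : FreeCD σ) = ⟨[x]⟩ ⊗ ⟨X⟩) ≫
        (𝟙 (⟨[x]⟩ : FreeCD σ) ⊗ₘ ε[(⟨X⟩ : FreeCD σ)]) ≫
        eqToHom (by subst e; rfl : (⟨[x]⟩ : FreeCD σ) ⊗ 𝟙_ (FreeCD σ) = ⟨[a]⟩)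
    else
      eqToHom (by rfl : (⟨x :: X⟩ : FreeCD σ) = ⟨[x]⟩ ⊗ ⟨X⟩) ≫
        (ε[(⟨[x]⟩ : FreeCD σ)] ⊗ₘ proj X a (List.mem_of_ne_of_mem e h)) ≫
        eqToHom (by rfl : 𝟙_ (FreeCD σ) ⊗ (⟨[a]⟩ : FreeCD σ) = ⟨[a]⟩)

/-- Auxiliary form of `wire`, by recursion on the output list. -/
noncomputable def wireAux (X : FreeCD σ) : (L : List σ.Obj) → (∀ a ∈ L, a ∈ X.word) →
    (X ⟶ (⟨L⟩ : FreeCD σ))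
  | [], _ => ε[X]
  | a :: L, h =>
      Δ[X] ≫ (proj X.word a (h a List.mem_cons_self) ⊗ₘ
        wireAux X L (fun b hb => h b (List.mem_cons_of_mem a hb))) ≫
      eqToHom (by rfl : (⟨[a]⟩ : FreeCD σ) ⊗ ⟨L⟩ = ⟨a :: L⟩)

/-- The structural morphism `X ⟶ Y`, for lists `X` and `Y` of generating objects such that all
entries of `Y` occur in `X`, in which every output wire is a copy of the input wire with the
same label. It copies, permutes and deletes wires according to labels: input wires without a
corresponding output are deleted, and it is a permutation of wires if `X` and `Y` are
rearrangements of each other without repetitions. It is used only for lists `X` without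
repetitions, so that the label determines the wire. -/
noncomputable def wire (X Y : FreeCD σ) (h : ∀ a ∈ Y.word, a ∈ X.word) : X ⟶ Y :=
  wireAux X Y.word h

end FreeCD

/-- The free CD-category on a signature. -/
abbrev freeCDCat (σ : MonoidalSignature.{u, w}) : CDCat.{max u w, u} where
  carrier := FreeCD σ

/-! ### Ordered DAGs -/

/-- A finite ordered DAG: a finite directed graph with a total order on its vertices such that
`v → w` implies `v < w` (in particular there are no directed cycles). -/
structure ODAG where
  V : Type u
  [fintype : Fintype V]
  [linearOrder : LinearOrder V]
  Edge : V → V → Prop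
  lt_of_edge : ∀ {v w : V}, Edge v w → v < w

attribute [instance] ODAG.fintype ODAG.linearOrder

namespace ODAG

/-- Order-preserving graph homomorphisms. The endpoints of an edge may be identified. -/
@[ext]
structure Hom (G G' : ODAG.{u}) where
  toFun : G.V → G'.V
  monotone : Monotone toFun
  map_edge : ∀ {v w : G.V}, G.Edge v w → toFun v = toFun w ∨ G'.Edge (toFun v) (toFun w)

/-- The category of ordered DAGs and order-preserving graph homomorphisms. -/
instance category : Category ODAG.{u} where
  Hom := Hom
  id G := ⟨fun v => v, fun _ _ h => h, fun h => Or.inr h⟩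
  comp α β := ⟨fun v => β.toFun (α.toFun v), fun _ _ h => β.monotone (α.monotone h), by
    intro v w h
    rcases α.map_edge h with h | h
    · exact Or.inl (congrArg β.toFun h)
    · exact β.map_edge h⟩

variable (G : ODAG.{u})

open Classical in
/-- The parents of a vertex. -/
noncomputable def parents (v : G.V) : Finset G.V := Finset.univ.filter (fun w => G.Edge w v)

variable {G} in
theorem mem_parents {v w : G.V} : w ∈ G.parents v ↔ G.Edge w v := by
  simp [parents]

/-- The signature of an ordered DAG: its generating objects are the vertices, and every vertex `v`
gives one generating morphism, from the parents of `v` (in increasing order) to `v`. -/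
noncomputable abbrev signature : MonoidalSignature.{u, u} where
  Obj := G.V
  Gen := G.V
  dom v := (G.parents v).sort
  cod v := [v]

/-- The syntax CD-category of an ordered DAG. -/
noncomputable abbrev cdSyn : CDCat.{u, u} := freeCDCat G.signature

/-- The tensor product of the vertices in `S`, in increasing order. -/
noncomputable def ob (S : Finset G.V) : FreeCD G.signature := ⟨S.sort⟩

/-- A single vertex as a generating object. -/
noncomputable def vertex (v : G.V) : FreeCD G.signature := ⟨[v]⟩

/-- The generating morphism of `v`, from the parents of `v` to `v`. -/
noncomputable def vertexGen (v : G.V) : G.ob (G.parents v) ⟶ G.vertex v :=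
  FreeCD.gen (σ := G.signature) v

/-- The inputs of a set of generating morphisms, given by the set `S` of their outputs: all parents
of elements of `S` that are not themselves in `S`. -/
noncomputable def inputs (S : Finset G.V) : Finset G.V := S.biUnion G.parents \ S

variable {G}

theorem mem_inputs {S : Finset G.V} {w : G.V} :
    w ∈ G.inputs S ↔ (∃ v ∈ S, G.Edge w v) ∧ w ∉ S := by
  simp [inputs, mem_parents]

theorem mem_ob {S : Finset G.V} {w : G.V} : w ∈ (G.ob S).word ↔ w ∈ S :=
  Finset.mem_sort _

theorem mem_vertex {v w : G.V} : w ∈ (G.vertex v).word ↔ w = v :=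
  List.mem_singleton

theorem mem_tensor {X Y : FreeCD G.signature} {w : G.V} :
    w ∈ (X ⊗ Y).word ↔ w ∈ X.word ∨ w ∈ Y.word :=
  List.mem_append

theorem ob_inputs_empty : G.ob (G.inputs ∅) = G.ob ∅ := by
  simp [inputs]

/-- The inputs needed after removing the largest element are available. -/
theorem wire_in_mem {S : Finset G.V} (h : S.Nonempty) :
    ∀ w ∈ (G.ob (G.inputs (S.erase (S.max' h))) ⊗ G.ob (G.inputs S)).word,
      w ∈ (G.ob (G.inputs S)).word := by
  intro w hw
  rcases mem_tensor.1 hw with hw | hw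
  · rw [mem_ob, mem_inputs] at hw ⊢
    obtain ⟨⟨v, hv, hwv⟩, hwS⟩ := hw
    have hvS := Finset.mem_of_mem_erase hv
    refine ⟨⟨v, hvS, hwv⟩, fun hw' => hwS (Finset.mem_erase.2 ⟨?_, hw'⟩)⟩
    exact ((G.lt_of_edge hwv).trans_le (S.le_max' v hvS)).ne
  · exact hw

/-- The parents of the largest element are among the other outputs and the inputs. -/
theorem wire_mid_mem {S : Finset G.V} (h : S.Nonempty) :
    ∀ w ∈ (G.ob (S.erase (S.max' h)) ⊗ G.ob (G.parents (S.max' h))).word,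
      w ∈ (G.ob (S.erase (S.max' h)) ⊗ G.ob (G.inputs S)).word := by
  intro w hw
  rw [mem_tensor] at hw ⊢
  rcases hw with hw | hw
  · exact Or.inl hw
  · rw [mem_ob, mem_parents] at hw
    rw [mem_ob, mem_ob, mem_inputs]
    by_cases hwS : w ∈ S
    · exact Or.inl (Finset.mem_erase.2 ⟨(G.lt_of_edge hw).ne, hwS⟩)
    · exact Or.inr ⟨⟨_, S.max'_mem h, hw⟩, hwS⟩

theorem wire_out_mem {S : Finset G.V} (h : S.Nonempty) :
    ∀ w ∈ (G.ob S).word,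
      w ∈ (G.ob (S.erase (S.max' h)) ⊗ G.vertex (S.max' h)).word := by
  intro w hw
  rw [mem_ob] at hw
  rw [mem_tensor, mem_ob, mem_vertex, Finset.mem_erase]
  tauto

/-- The copy-composition of a set of generating morphisms, given by the set `S` of their outputs.
It is the identity of the unit for `S = ∅`. Otherwise let `m` be the largest element of `S` and
`S'` the rest of `S`. The inputs of `S` are copied; one copy, restricted to the inputs of `S'`, is
fed to the copy-composition of `S'`. The outputs of `S'` are copied as well; one copy is output,
and the generating morphism of `m` takes its arguments from the other copies of the outputs of
`S'` and of the inputs, everything that is not an argument of it being deleted. -/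
noncomputable def copyComp (S : Finset G.V) : G.ob (G.inputs S) ⟶ G.ob S :=
  if h : S.Nonempty then
    FreeCD.wire (G.ob (G.inputs S))
        (G.ob (G.inputs (S.erase (S.max' h))) ⊗ G.ob (G.inputs S)) (wire_in_mem h) ≫
      (copyComp (S.erase (S.max' h)) ⊗ₘ 𝟙 (G.ob (G.inputs S))) ≫
      FreeCD.wire (G.ob (S.erase (S.max' h)) ⊗ G.ob (G.inputs S))
        (G.ob (S.erase (S.max' h)) ⊗ G.ob (G.parents (S.max' h))) (wire_mid_mem h) ≫
      (𝟙 (G.ob (S.erase (S.max' h))) ⊗ₘ G.vertexGen (S.max' h)) ≫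
      FreeCD.wire (G.ob (S.erase (S.max' h)) ⊗ G.vertex (S.max' h)) (G.ob S) (wire_out_mem h)
  else
    eqToHom (by rw [Finset.not_nonempty_iff_eq_empty.1 h, ob_inputs_empty])
termination_by S.card
decreasing_by exact Finset.card_erase_lt_of_mem (S.max'_mem h)

variable {G' : ODAG.{u}}

/-- The preimage of a vertex. -/
def preimage (α : G ⟶ G') (v : G'.V) : Finset G.V :=
  Finset.univ.filter (fun w => α.toFun w = v)

theorem mem_preimage {α : G ⟶ G'} {v : G'.V} {w : G.V} :
    w ∈ preimage α v ↔ α.toFun w = v := by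
  simp [preimage]

/-- The tensor product, over the entries `v` of a list of vertices of `G'`, of the preimages of `v`,
each of them listed in increasing order. -/
noncomputable def pullObj (α : G ⟶ G') (X : FreeCD G'.signature) : FreeCD G.signature :=
  ⟨X.word.flatMap (fun v => (preimage α v).sort)⟩

theorem pullObj_vertex (α : G ⟶ G') (v : G'.V) :
    pullObj α (G'.vertex v) = G.ob (preimage α v) :=
  congrArg FreeCD.mk (List.flatMap_singleton _ v)

theorem mem_pullObj {α : G ⟶ G'} {S : Finset G'.V} {w : G.V} :
    w ∈ (pullObj α (G'.ob S)).word ↔ α.toFun w ∈ S := by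
  refine List.mem_flatMap.trans ?_
  simp only [Finset.mem_sort, mem_preimage]
  constructor
  · rintro ⟨v, hv, rfl⟩
    exact mem_ob.1 hv
  · exact fun h => ⟨_, mem_ob.2 h, rfl⟩

/-- The inputs of the generating morphisms over `v` lie over the parents of `v`. -/
theorem wire_pull_mem (α : G ⟶ G') (v : G'.V) :
    ∀ w ∈ (G.ob (G.inputs (preimage α v))).word,
      w ∈ (pullObj α (G'.ob (G'.parents v))).word := by
  intro w hw
  rw [mem_ob, mem_inputs] at hw
  obtain ⟨⟨x, hx, hwx⟩, hw⟩ := hw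
  rw [mem_preimage] at hx hw
  rw [mem_pullObj, mem_parents]
  rcases α.map_edge hwx with h | h
  · exact absurd (h.trans hx) hw
  · rwa [hx] at h

/-- The image of the generating morphism of `v`: among the vertices over the parents of `v`, those
that are not inputs of the generating morphisms over `v` are deleted, and the copy-composition of
the generating morphisms over `v` is applied to the others. -/
noncomputable def pullGen (α : G ⟶ G') (v : G'.V) :
    pullObj α (G'.ob (G'.parents v)) ⟶ G.ob (preimage α v) :=
  FreeCD.wire (pullObj α (G'.ob (G'.parents v))) (G.ob (G.inputs (preimage α v)))
      (wire_pull_mem α v) ≫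
    copyComp (preimage α v)

/-- The CD-functor `Φ` sends every vertex of `G'` to the tensor product of its preimage (hence a
list of vertices to the tensor product of these tensor products), and every generating morphism
to the copy-composition of the generating morphisms over it, preceded by deletions. -/
structure IsPreimageFunctor (α : G ⟶ G')
    (Φ : CDFunctor (FreeCD G'.signature) (FreeCD G.signature)) : Prop where
  obj_eq : ∀ X : FreeCD G'.signature, Φ.obj X = pullObj α X
  map_gen : ∀ v : G'.V, Φ.map (G'.vertexGen v) =
    eqToHom (obj_eq (G'.ob (G'.parents v))) ≫ pullGen α v ≫
      eqToHom ((obj_eq (G'.vertex v)).trans (pullObj_vertex α v)).symm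

end ODAG

/-! Existence and uniqueness of the CD-functor for a single `α` come from the universal property of
the free CD-category: a CD-functor out of it is determined by objects and generators
(`CDFunctor.ext_of_gen`), and any interpretation of these extends (`Interpretation.lift`). By
uniqueness (`IsPreimageFunctor.eq`), functoriality reduces to checking that identities and
composites have the prescribed values on objects and generators. The real content is that a pullback
functor sends copy-compositions to copy-compositions.

For this, a copy-composition is rewritten as a `run` (`copyComp_eq_run`). Its state is a word of
labelled wires; each step applies some `g_v` to copies of available wires and adds the output to the
state; a selection of wires ends the run. Because no wire is lost and labels identify wires, runs
absorb selections, concatenate (`run_comp_run`) and can be performed while keeping a copy of the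
initial state (`pair_id_run`). Generators cannot be duplicated or discarded, so the calculus of
tuples and projections is used for the structural morphisms only, which are deterministic.

A pullback functor sends selections to selections (`pullMap_wire`) and the step of `v` to the run
over the fibre of `v` (`pullMap_step`), hence a run over `L` to the run over the concatenated fibres
(`pullMap_run`). As the maps are monotone, concatenating the sorted fibres over a sorted fibre gives
the sorted fibre of the composite (`flatMap_preimage_sort`), so both sides of the composition law
are the same run. -/

/-! ### Pairing and deterministic morphisms in a CD-category. -/

namespace CategoryTheory.CopyDiscardCategory

variable {C : Type u} [Category.{v} C] [MonoidalCategory C] [CopyDiscardCategory C]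

/-- The comonoid structure of a tensor product that belongs to the copy-discard structure. It takes
precedence over the one built from the comonoid structures of the factors. -/
@[reducible] instance tensorComonObj (X Y : C) : ComonObj (X ⊗ Y) := comonObj (X ⊗ Y)

/-- The morphism that applies `f` and `g` to two copies of its input. -/
def pair {X Y Z : C} (f : X ⟶ Y) (g : X ⟶ Z) : X ⟶ Y ⊗ Z := Δ[X] ≫ (f ⊗ₘ g)

theorem pair_comp_tensorHom {X Y Z Y' Z' : C} (f : X ⟶ Y) (g : X ⟶ Z) (h : Y ⟶ Y')
    (k : Z ⟶ Z') : pair f g ≫ (h ⊗ₘ k) = pair (f ≫ h) (g ≫ k) := by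
  simp [pair]

theorem comp_pair {W X Y Z : C} (d : W ⟶ X) [Deterministic d] (f : X ⟶ Y) (g : X ⟶ Z) :
    d ≫ pair f g = pair (d ≫ f) (d ≫ g) := by
  simp [pair]

theorem pair_comp_braiding {X Y Z : C} (f : X ⟶ Y) (g : X ⟶ Z) :
    pair f g ≫ (β_ Y Z).hom = pair g f := by
  simp [pair, BraidedCategory.braiding_naturality]

theorem pair_comp_associator {X Y Z W : C} (f : X ⟶ Y) (g : X ⟶ Z) (h : X ⟶ W) :
    pair (pair f g) h ≫ (α_ Y Z W).hom = pair f (pair g h) := by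
  have h₁ : (Δ[X] ≫ (f ⊗ₘ g)) ⊗ₘ h = Δ[X] ▷ X ≫ ((f ⊗ₘ g) ⊗ₘ h) := by
    rw [← tensorHom_id, tensorHom_comp_tensorHom, Category.id_comp]
  have h₂ : f ⊗ₘ (Δ[X] ≫ (g ⊗ₘ h)) = X ◁ Δ[X] ≫ (f ⊗ₘ (g ⊗ₘ h)) := by
    rw [← id_tensorHom, tensorHom_comp_tensorHom, Category.id_comp]
  rw [pair, pair, pair, pair, h₁, h₂, Category.assoc, Category.assoc, associator_naturality,
    ComonObj.comul_assoc_assoc]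

theorem pair_discard_left {X Y : C} (g : X ⟶ Y) : pair ε[X] g ≫ (λ_ Y).hom = g := by
  simp [pair]

theorem pair_discard_right {X Y : C} (f : X ⟶ Y) : pair f ε[X] ≫ (ρ_ Y).hom = f := by
  simp [pair]

/-- Coassociativity regroups the four copies so that the middle two are the outputs of a single copy
map; cocommutativity then absorbs their exchange. This is what makes copying itself deterministic.
-/
theorem copy_comp_copy_tensor_copy (X : C) :
    Δ[X] ≫ (Δ[X] ⊗ₘ Δ[X]) ≫ tensorμ X X X X = Δ[X] ≫ (Δ[X] ⊗ₘ Δ[X]) := by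
  have key : Δ[X] ≫ X ◁ Δ[X] ≫ (α_ X X X).inv ≫ (β_ X X).hom ▷ X ≫ (α_ X X X).hom =
      Δ[X] ≫ X ◁ Δ[X] := by
    rw [← ComonObj.comul_assoc_flip_assoc, ← comp_whiskerRight_assoc,
      IsCommComonObj.comul_comm, ComonObj.comul_assoc]
  have expand : Δ[X] ≫ (Δ[X] ⊗ₘ Δ[X]) ≫ (α_ X X (X ⊗ X)).hom =
      Δ[X] ≫ X ◁ (Δ[X] ≫ X ◁ Δ[X]) := by
    rw [MonoidalCategory.tensorHom_def, Category.assoc, associator_naturality_right,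
      ← ComonObj.comul_assoc_assoc, whiskerLeft_comp]
  rw [tensorμ, reassoc_of% expand, ← whiskerLeft_comp_assoc, ← whiskerLeft_comp_assoc,
    ← whiskerLeft_comp_assoc, Category.assoc, Category.assoc, Category.assoc, key,
    ← reassoc_of% expand]
  simp

instance deterministic_copy (X : C) : Deterministic Δ[X] where
  hom_counit := by
    rw [discard_tensor, ComonObj.counit_comul_hom_assoc]
    simp
  hom_comul := by
    rw [copy_tensor, copy_comp_copy_tensor_copy]

instance deterministic_discard (X : C) : Deterministic ε[X] where
  hom_counit := by
    rw [discard_unit]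
    simp
  hom_comul := by
    rw [copy_unit, ComonObj.counit_comul_hom]

instance deterministic_tensorHom {X Y X' Y' : C} (f : X ⟶ Y) (g : X' ⟶ Y') [Deterministic f]
    [Deterministic g] : Deterministic (f ⊗ₘ g) where
  hom_counit := by
    rw [discard_tensor, discard_tensor]
    simp
  hom_comul := by
    rw [copy_tensor, copy_tensor, Category.assoc, ← tensorμ_natural,
      tensorHom_comp_tensorHom_assoc, tensorHom_comp_tensorHom_assoc, IsComonHom.hom_comul,
      IsComonHom.hom_comul]

instance deterministic_pair {X Y Z : C} (f : X ⟶ Y) (g : X ⟶ Z) [Deterministic f]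
    [Deterministic g] : Deterministic (pair f g) :=
  inferInstanceAs (Deterministic (Δ[X] ≫ (f ⊗ₘ g)))

/-- The copy of a tensor product copies both factors and exchanges the middle wires. These are the
ones deleted here, so by naturality the exchange takes place between units, and the counit laws
finish. -/
theorem pair_discards_eq_id {X Y : C} :
    pair ((𝟙 X ⊗ₘ ε[Y]) ≫ (ρ_ X).hom) ((ε[X] ⊗ₘ 𝟙 Y) ≫ (λ_ Y).hom) = 𝟙 (X ⊗ Y) := by
  have unit : tensorμ X (𝟙_ C) (𝟙_ C) Y = 𝟙 _ := by
    simp only [tensorμ, braiding_tensorUnit_left]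
    monoidal
  rw [← pair_comp_tensorHom, pair, copy_tensor, Category.assoc, Category.assoc,
    ← reassoc_of% (tensorμ_natural (𝟙 X) ε[X] ε[Y] (𝟙 Y)), tensorHom_comp_tensorHom_assoc,
    ComonObj.comul_counit_hom, ComonObj.counit_comul_hom]
  simp [unit, tensorHom_comp_tensorHom]

end CategoryTheory.CopyDiscardCategory

/-! ### Calculus of labelled wires in a free CD-category. -/

namespace FreeCD

open CopyDiscardCategory

variable {σ : MonoidalSignature.{u, w}}

/-- The words `[] ++ L` and `L` agree by definition, so the unitor can be suppressed. On the right
this works only for explicit words, hence the one-letter target in `pair_discard_right'`. -/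
theorem pair_discard_left' {X Y : FreeCD σ} (g : X ⟶ Y) :
    (pair ε[X] g : X ⟶ 𝟙_ (FreeCD σ) ⊗ Y) = g :=
  (Category.comp_id _).symm.trans (pair_discard_left g)

theorem pair_discard_right' {X : FreeCD σ} {a : σ.Obj} (f : X ⟶ ⟨[a]⟩) :
    (pair f ε[X] : X ⟶ ⟨[a]⟩ ⊗ 𝟙_ (FreeCD σ)) = f :=
  (Category.comp_id _).symm.trans (pair_discard_right f)

theorem proj_cons_self (a : σ.Obj) (X : FreeCD σ) (h : a ∈ a :: X.word) :
    proj (a :: X.word) a h = 𝟙 (⟨[a]⟩ : FreeCD σ) ⊗ₘ ε[X] := by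
  rw [proj, dif_pos rfl]
  exact (Category.id_comp _).trans (Category.comp_id _)

theorem proj_cons_of_ne {a x : σ.Obj} (e : a ≠ x) (X : FreeCD σ) (h : a ∈ x :: X.word)
    (h' : a ∈ X.word) :
    proj (x :: X.word) a h = ε[(⟨[x]⟩ : FreeCD σ)] ⊗ₘ proj X.word a h' := by
  rw [proj, dif_neg e]
  exact (Category.id_comp _).trans (Category.comp_id _)

theorem wire_cons (X Y : FreeCD σ) (a : σ.Obj)
    (h : ∀ b ∈ ((⟨[a]⟩ : FreeCD σ) ⊗ Y).word, b ∈ X.word) :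
    wire X (⟨[a]⟩ ⊗ Y) h = pair (proj X.word a (h a List.mem_cons_self))
      (wire X Y fun b hb => h b (List.mem_cons_of_mem a hb)) := by
  refine Eq.trans ?_ (Category.comp_id _)
  exact (Category.assoc _ _ _).symm

/-- Induction on the word of an object. -/
theorem word_induction {P : FreeCD σ → Prop} (unit : P (𝟙_ _))
    (cons : ∀ (a : σ.Obj) (X : FreeCD σ), P X → P (⟨[a]⟩ ⊗ X)) (X : FreeCD σ) : P X := by
  obtain ⟨L⟩ := X
  induction L with
  | nil => exact unit
  | cons a L ih => exact cons a ⟨L⟩ ih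

/-- A structural morphism is the tuple of the projections to its output labels; coassociativity
allows a tuple to be split at any place. -/
theorem wire_tensor (Z P Q : FreeCD σ) (h : ∀ a ∈ (P ⊗ Q).word, a ∈ Z.word) :
    wire Z (P ⊗ Q) h = pair (wire Z P fun a ha => h a (List.mem_append_left _ ha))
      (wire Z Q fun a ha => h a (List.mem_append_right _ ha)) := by
  induction P using word_induction with
  | unit => exact (pair_discard_left' _).symm
  | cons a P ih =>
    refine (wire_cons Z (P ⊗ Q) a h).trans ?_
    rw [ih, wire_cons]
    exact (pair_comp_associator _ _ _).symm.trans (Category.comp_id _)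

instance deterministic_proj (X : List σ.Obj) (a : σ.Obj) (h : a ∈ X) :
    Deterministic (proj X a h) := by
  induction X with
  | nil => exact absurd h List.not_mem_nil
  | cons x X ih =>
    by_cases e : a = x
    · subst e
      rw [proj_cons_self a ⟨X⟩]
      exact deterministic_tensorHom _ _
    · have h' := List.mem_of_ne_of_mem e h
      have := ih h'
      rw [proj_cons_of_ne e ⟨X⟩ h h']
      exact deterministic_tensorHom _ _

instance deterministic_wire (X Y : FreeCD σ) (h : ∀ a ∈ Y.word, a ∈ X.word) :
    Deterministic (wire X Y h) := by
  induction Y using word_induction with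
  | unit => exact deterministic_discard X
  | cons a Y ih =>
    rw [wire_cons]
    have := ih fun b hb => h b (List.mem_cons_of_mem a hb)
    exact deterministic_pair _ _

/-- A deterministic morphism that is compatible with all projections is compatible with wires. -/
theorem comp_wire_of_comp_proj {X X' : FreeCD σ} (d : X ⟶ X') [Deterministic d] (Y : FreeCD σ)
    (h : ∀ a ∈ Y.word, a ∈ X.word) (h' : ∀ a ∈ Y.word, a ∈ X'.word)
    (hd : ∀ (a : σ.Obj) (ha : a ∈ Y.word),
      d ≫ proj X'.word a (h' a ha) = proj X.word a (h a ha)) :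
    d ≫ wire X' Y h' = wire X Y h := by
  induction Y using word_induction with
  | unit => exact IsComonHom.hom_counit d
  | cons a Y ih =>
    rw [wire_cons, wire_cons, comp_pair, hd a List.mem_cons_self,
      ih _ _ fun b hb => hd b (List.mem_cons_of_mem a hb)]

/-- Repetitions in `Y` do no harm: all occurrences of a label are copies of the same input wire. The
other entries of the tuple disappear because they are deterministic. -/
theorem wire_comp_proj (X Y : FreeCD σ) (h : ∀ a ∈ Y.word, a ∈ X.word) (a : σ.Obj)
    (ha : a ∈ Y.word) : wire X Y h ≫ proj Y.word a ha = proj X.word a (h a ha) := by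
  induction Y using word_induction with
  | unit => exact absurd ha List.not_mem_nil
  | cons y Y ih =>
    rw [wire_cons]
    by_cases e : a = y
    · subst e
      refine (congrArg _ (proj_cons_self a Y ha)).trans ?_
      rw [pair_comp_tensorHom, Category.comp_id, IsComonHom.hom_counit]
      exact pair_discard_right' _
    · have h' := List.mem_of_ne_of_mem e ha
      refine (congrArg _ (proj_cons_of_ne e Y ha h')).trans ?_
      rw [pair_comp_tensorHom, IsComonHom.hom_counit, ih _ h']
      exact pair_discard_left' _

theorem wire_comp_wire (X Y Z : FreeCD σ) (h : ∀ a ∈ Y.word, a ∈ X.word)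
    (h' : ∀ a ∈ Z.word, a ∈ Y.word) :
    wire X Y h ≫ wire Y Z h' = wire X Z fun a ha => h a (h' a ha) :=
  comp_wire_of_comp_proj _ _ _ _ fun a ha => wire_comp_proj X Y h a (h' a ha)

/-- The projection to the first factor. -/
def fst (X Y : FreeCD σ) : X ⊗ Y ⟶ X := (𝟙 X ⊗ₘ ε[Y]) ≫ (ρ_ X).hom

/-- The projection to the second factor. -/
def snd (X Y : FreeCD σ) : X ⊗ Y ⟶ Y := (ε[X] ⊗ₘ 𝟙 Y) ≫ (λ_ Y).hom

theorem deterministic_eqToHom {X Y : FreeCD σ} (h : X = Y) : Deterministic (eqToHom h) := by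
  subst h
  exact inferInstanceAs (Deterministic (𝟙 X))

instance deterministic_fst (X Y : FreeCD σ) : Deterministic (fst X Y) := by
  have : Deterministic (ρ_ X).hom :=
    deterministic_eqToHom (IsStrictMonoidal.tensor_unit X)
  exact inferInstanceAs (Deterministic ((𝟙 X ⊗ₘ ε[Y]) ≫ (ρ_ X).hom))

instance deterministic_snd (X Y : FreeCD σ) : Deterministic (snd X Y) := by
  have : Deterministic (λ_ Y).hom :=
    deterministic_eqToHom (IsStrictMonoidal.unit_tensor Y)
  exact inferInstanceAs (Deterministic ((ε[X] ⊗ₘ 𝟙 Y) ≫ (λ_ Y).hom))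

theorem fst_tensor (A X Y : FreeCD σ) :
    fst (A ⊗ X) Y = (α_ A X Y).hom ≫ (𝟙 A ⊗ₘ fst X Y) := by
  simp [fst]

theorem snd_tensor (A X Y : FreeCD σ) :
    snd (A ⊗ X) Y = (α_ A X Y).hom ≫ (ε[A] ⊗ₘ snd X Y) ≫ (λ_ Y).hom := by
  rw [snd, snd, discard_tensor, MonoidalCategory.tensorHom_def, MonoidalCategory.tensorHom_def,
    MonoidalCategory.tensorHom_def, MonoidalCategory.tensorHom_def]
  simp

theorem fst_comp_proj (X Y : FreeCD σ) (a : σ.Obj) (h : a ∈ X.word)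
    (h' : a ∈ (X ⊗ Y).word) : fst X Y ≫ proj X.word a h = proj (X ⊗ Y).word a h' := by
  induction X using word_induction with
  | unit => exact absurd h List.not_mem_nil
  | cons x X ih =>
    have e₁ : fst (⟨[x]⟩ ⊗ X) Y = 𝟙 ⟨[x]⟩ ⊗ₘ fst X Y :=
      (fst_tensor _ _ _).trans (Category.id_comp _)
    rw [e₁]
    by_cases e : a = x
    · subst e
      refine (congrArg _ (proj_cons_self a X h)).trans ?_
      refine Eq.trans ?_ (proj_cons_self a (X ⊗ Y) h').symm
      rw [tensorHom_comp_tensorHom, IsComonHom.hom_counit, Category.comp_id]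
    · have h₁ := List.mem_of_ne_of_mem e h
      have h₂ := List.mem_of_ne_of_mem e h'
      refine (congrArg _ (proj_cons_of_ne e X h h₁)).trans ?_
      refine Eq.trans ?_ (proj_cons_of_ne e (X ⊗ Y) h' h₂).symm
      rw [tensorHom_comp_tensorHom, Category.id_comp, ih h₁ h₂]

/-- `proj` selects the first occurrence of a label, so the label must not occur in the left factor.
The disjointness assumptions in the lemmas on tensor products of wires have this origin. -/
theorem snd_comp_proj (X Y : FreeCD σ) (a : σ.Obj) (hX : a ∉ X.word) (h : a ∈ Y.word)
    (h' : a ∈ (X ⊗ Y).word) : snd X Y ≫ proj Y.word a h = proj (X ⊗ Y).word a h' := by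
  induction X using word_induction with
  | unit =>
    have e₁ : snd (𝟙_ _) Y = 𝟙 Y := by
      rw [snd, discard_unit, id_tensorHom_id, Category.id_comp]
      rfl
    rw [e₁]
    exact Category.id_comp _
  | cons x X ih =>
    have e : a ≠ x := fun e => hX (e ▸ List.mem_cons_self)
    have hX' : a ∉ X.word := fun ha => hX (List.mem_cons_of_mem x ha)
    have h₂ : a ∈ (X ⊗ Y).word := List.mem_append_right _ h
    have e₁ : snd (⟨[x]⟩ ⊗ X) Y = (ε[(⟨[x]⟩ : FreeCD σ)] ⊗ₘ snd X Y) ≫ (λ_ Y).hom :=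
      (snd_tensor _ _ _).trans (Category.id_comp _)
    rw [e₁]
    refine Eq.trans ?_ (proj_cons_of_ne e (X ⊗ Y) h' h₂).symm
    rw [Category.assoc, ← leftUnitor_naturality, ← id_tensorHom, tensorHom_comp_tensorHom_assoc,
      Category.comp_id, ih hX' h₂]
    exact Category.comp_id _

theorem fst_comp_wire (X X' Y : FreeCD σ) (h : ∀ a ∈ Y.word, a ∈ X.word) :
    fst X X' ≫ wire X Y h = wire (X ⊗ X') Y fun a ha => List.mem_append_left _ (h a ha) :=
  comp_wire_of_comp_proj _ _ _ _ fun a ha => fst_comp_proj _ _ a (h a ha) _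

theorem snd_comp_wire (X X' Y : FreeCD σ) (h : ∀ a ∈ Y.word, a ∈ X'.word)
    (hX : ∀ a ∈ Y.word, a ∉ X.word) :
    snd X X' ≫ wire X' Y h = wire (X ⊗ X') Y fun a ha => List.mem_append_right _ (h a ha) :=
  comp_wire_of_comp_proj _ _ _ _ fun a ha => snd_comp_proj _ _ a (hX a ha) (h a ha) _

theorem pair_fst_snd (X Y : FreeCD σ) : pair (fst X Y) (snd X Y) = 𝟙 (X ⊗ Y) :=
  pair_discards_eq_id

/-- The first label gives the first projection, and the remaining labels, being different from it,
factor through the second. With a repeated label both outputs would be copies of the first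
occurrence. -/
theorem wire_self (X : FreeCD σ) (hX : X.word.Nodup) (h : ∀ a ∈ X.word, a ∈ X.word) :
    wire X X h = 𝟙 X := by
  induction X using word_induction with
  | unit => exact discard_unit
  | cons x X ih =>
    have hX' := List.nodup_cons.1 hX
    have e : proj (x :: X.word) x List.mem_cons_self = fst ⟨[x]⟩ X :=
      (proj_cons_self x X _).trans (Category.comp_id _).symm
    rw [wire_cons]
    refine (congrArg (pair · _) e).trans ?_
    rw [← snd_comp_wire _ _ _ (fun _ ha => ha), ih hX'.2, Category.comp_id, pair_fst_snd]
    intro a ha ha'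
    rw [List.mem_singleton.1 ha'] at ha
    exact hX'.1 ha

theorem wire_tensorHom_wire (X Y X' Y' : FreeCD σ) (h : ∀ a ∈ Y.word, a ∈ X.word)
    (h' : ∀ a ∈ Y'.word, a ∈ X'.word) (hX : ∀ a ∈ Y'.word, a ∉ X.word)
    (h'' : ∀ a ∈ (Y ⊗ Y').word, a ∈ (X ⊗ X').word) :
    wire X Y h ⊗ₘ wire X' Y' h' = wire (X ⊗ X') (Y ⊗ Y') h'' := by
  rw [wire_tensor, ← fst_comp_wire _ _ _ h, ← snd_comp_wire _ _ _ h' hX, ← pair_comp_tensorHom,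
    pair_fst_snd, Category.id_comp]

theorem wire_tensorHom_id (X Y Z : FreeCD σ) (h : ∀ a ∈ Y.word, a ∈ X.word)
    (hZ : Z.word.Nodup) (hX : ∀ a ∈ Z.word, a ∉ X.word)
    (h' : ∀ a ∈ (Y ⊗ Z).word, a ∈ (X ⊗ Z).word) :
    wire X Y h ⊗ₘ 𝟙 Z = wire (X ⊗ Z) (Y ⊗ Z) h' := by
  rw [← wire_self Z hZ fun _ ha => ha, wire_tensorHom_wire _ _ _ _ _ _ hX]

theorem wire_tensor_comp_wire_tensorHom_id (Z P P' Q : FreeCD σ)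
    (h : ∀ a ∈ (P ⊗ Q).word, a ∈ Z.word) (h' : ∀ a ∈ P'.word, a ∈ P.word) :
    wire Z (P ⊗ Q) h ≫ (wire P P' h' ⊗ₘ 𝟙 Q) = wire Z (P' ⊗ Q) fun a ha =>
      h a ((List.mem_append.1 ha).elim (fun ha => List.mem_append_left _ (h' a ha))
        (List.mem_append_right _)) := by
  rw [wire_tensor, wire_tensor, pair_comp_tensorHom, wire_comp_wire, Category.comp_id]

theorem wire_tensor_comp_braiding (Z P Q : FreeCD σ) (h : ∀ a ∈ (P ⊗ Q).word, a ∈ Z.word) :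
    wire Z (P ⊗ Q) h ≫ (β_ P Q).hom =
      wire Z (Q ⊗ P) fun a ha => h a (List.mem_append.2 (List.mem_append.1 ha).symm) := by
  rw [wire_tensor, wire_tensor, pair_comp_braiding]

theorem eqToHom_comp_wire {X X' : FreeCD σ} (e : X = X') (Y : FreeCD σ)
    (h : ∀ a ∈ Y.word, a ∈ X'.word) :
    eqToHom e ≫ wire X' Y h = wire X Y fun a ha => e ▸ h a ha := by
  subst e
  exact Category.id_comp _

theorem wire_comp_eqToHom {Y Y' : FreeCD σ} (e : Y = Y') (X : FreeCD σ)
    (h : ∀ a ∈ Y.word, a ∈ X.word) :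
    wire X Y h ≫ eqToHom e = wire X Y' fun a ha => h a (e ▸ ha) := by
  subst e
  exact Category.comp_id _

theorem eqToHom_eq_wire {X Y : FreeCD σ} (e : X = Y) (hX : X.word.Nodup)
    (h : ∀ a ∈ Y.word, a ∈ X.word) : eqToHom e = wire X Y h := by
  subst e
  exact (wire_self X hX h).symm

end FreeCD

/-! ### Runs: sequential application of generators with all wires kept. -/

namespace ODAG

open CopyDiscardCategory FreeCD

variable {G : ODAG.{u}}

/-- The generating morphisms of the vertices in `L` can be applied one after the other, starting
from wires `X`, each of them to wires that are available and adding a new wire, and the wires `Y`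
are available in the end. -/
def Runnable : FreeCD G.signature → List G.V → FreeCD G.signature → Prop
  | X, [], Y => ∀ a ∈ Y.word, a ∈ X.word
  | X, v :: L, Y => (∀ a ∈ (G.ob (G.parents v)).word, a ∈ X.word) ∧ v ∉ X.word ∧
      Runnable (X ⊗ G.vertex v) L Y

/-- Application of the generating morphism of `v` to copies of wires in `X`, keeping all wires. -/
noncomputable def step (X : FreeCD G.signature) (v : G.V)
    (h : ∀ a ∈ (G.ob (G.parents v)).word, a ∈ X.word) : X ⟶ X ⊗ G.vertex v :=
  pair (𝟙 X) (wire X (G.ob (G.parents v)) h ≫ G.vertexGen v)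

/-- Application of the generating morphisms of the vertices in `L` one after the other, starting
from wires `X` and keeping all wires, followed by the selection of the wires `Y`. -/
noncomputable def run : (X : FreeCD G.signature) → (L : List G.V) → (Y : FreeCD G.signature) →
    Runnable X L Y → (X ⟶ Y)
  | X, [], Y, h => wire X Y h
  | X, v :: L, Y, h => step X v h.1 ≫ run (X ⊗ G.vertex v) L Y h.2.2

/-- The target enters only in the final selection, so any word in the labels of `X` and `L` may
replace it. -/
theorem Runnable.of_mem {X Y Z : FreeCD G.signature} {L : List G.V} (h : Runnable X L Z)
    (h' : ∀ a ∈ Y.word, a ∈ X.word ∨ a ∈ L) : Runnable X L Y := by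
  induction L generalizing X with
  | nil => exact fun a ha => (h' a ha).resolve_right List.not_mem_nil
  | cons v L ih =>
    refine ⟨h.1, h.2.1, ih h.2.2 fun a ha => ?_⟩
    rcases h' a ha with ha | ha
    · exact Or.inl (List.mem_append_left _ ha)
    · rcases List.mem_cons.1 ha with rfl | ha
      · exact Or.inl (List.mem_append_right _ List.mem_cons_self)
      · exact Or.inr ha

theorem Runnable.mem {X Y : FreeCD G.signature} {L : List G.V} (h : Runnable X L Y) :
    ∀ a ∈ Y.word, a ∈ X.word ∨ a ∈ L := by
  induction L generalizing X with
  | nil => exact fun a ha => Or.inl (h a ha)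
  | cons v L ih =>
    intro a ha
    rcases ih h.2.2 a ha with ha | ha
    · rcases List.mem_append.1 ha with ha | ha
      · exact Or.inl ha
      · exact Or.inr (List.mem_singleton.1 ha ▸ List.mem_cons_self)
    · exact Or.inr (List.mem_cons_of_mem v ha)

theorem Runnable.append {X Y : FreeCD G.signature} {L M : List G.V}
    (h : Runnable X L (X ⊗ ⟨L⟩)) (h' : Runnable (X ⊗ ⟨L⟩) M Y) : Runnable X (L ++ M) Y := by
  induction L generalizing X with
  | nil =>
    have e : X ⊗ (⟨[]⟩ : FreeCD G.signature) = X := IsStrictMonoidal.tensor_unit X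
    rwa [e] at h'
  | cons v L ih =>
    have e : (X ⊗ G.vertex v) ⊗ (⟨L⟩ : FreeCD G.signature) = X ⊗ ⟨v :: L⟩ :=
      IsStrictMonoidal.tensor_assoc X (G.vertex v) ⟨L⟩
    rw [← e] at h'
    exact ⟨h.1, h.2.1, ih (h.2.2.of_mem fun a ha => List.mem_append.1 ha) h'⟩

/-- Vertices in increasing order are runnable if all their parents are available. -/
theorem runnable_of_pairwise {X Y : FreeCD G.signature} {L : List G.V} (hL : L.Pairwise (· < ·))
    (hX : ∀ v ∈ L, v ∉ X.word) (hp : ∀ v ∈ L, ∀ w, G.Edge w v → w ∈ X.word ∨ w ∈ L)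
    (hY : ∀ a ∈ Y.word, a ∈ X.word ∨ a ∈ L) : Runnable X L Y := by
  induction L generalizing X with
  | nil => exact fun a ha => (hY a ha).resolve_right List.not_mem_nil
  | cons v L ih =>
    have shift : ∀ a, a ∈ X.word ∨ a ∈ v :: L → a ∈ (X ⊗ G.vertex v).word ∨ a ∈ L := by
      intro a ha
      rw [mem_tensor, mem_vertex]
      rw [List.mem_cons] at ha
      tauto
    obtain ⟨hv, hL'⟩ := List.pairwise_cons.1 hL
    refine ⟨fun a ha => ?_, hX v List.mem_cons_self, ih hL' (fun w hw hw' => ?_)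
      (fun w hw x hx => shift x (hp w (List.mem_cons_of_mem v hw) x hx))
      (fun a ha => shift a (hY a ha))⟩
    · have ha' := mem_parents.1 (mem_ob.1 ha)
      refine (hp v List.mem_cons_self a ha').resolve_right fun h => ?_
      rcases List.mem_cons.1 h with h | h
      · exact (G.lt_of_edge ha').ne h
      · exact (G.lt_of_edge ha').asymm (hv a h)
    · rcases mem_tensor.1 hw' with h | h
      · exact hX w (List.mem_cons_of_mem v hw) h
      · exact (hv w hw).ne' (mem_vertex.1 h)

/-- A step finds its arguments by label, so a selection of wires may be postponed. Freshness of `v`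
keeps the new wire distinct from an old one. -/
theorem wire_comp_step {X X' : FreeCD G.signature} (v : G.V) (h : ∀ a ∈ X'.word, a ∈ X.word)
    (h' : ∀ a ∈ (G.ob (G.parents v)).word, a ∈ X'.word) (hv : v ∉ X.word)
    (h'' : ∀ a ∈ (X' ⊗ G.vertex v).word, a ∈ (X ⊗ G.vertex v).word) :
    wire X X' h ≫ step X' v h' =
      step X v (fun a ha => h a (h' a ha)) ≫ wire (X ⊗ G.vertex v) (X' ⊗ G.vertex v) h'' := by
  rw [step, step, comp_pair, reassoc_of% @wire_comp_wire, ← wire_tensorHom_id X X' (G.vertex v) h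
    (List.nodup_singleton v), pair_comp_tensorHom, Category.comp_id, Category.comp_id,
    Category.id_comp]
  intro a ha
  rwa [mem_vertex.1 ha]

theorem wire_comp_run {X X' Y : FreeCD G.signature} {L : List G.V}
    (h : ∀ a ∈ X'.word, a ∈ X.word) (h' : Runnable X' L Y) (hr : Runnable X L Y) :
    wire X X' h ≫ run X' L Y h' = run X L Y hr := by
  induction L generalizing X X' with
  | nil => exact wire_comp_wire _ _ _ _ _
  | cons v L ih =>
    have h'' : ∀ a ∈ (X' ⊗ G.vertex v).word, a ∈ (X ⊗ G.vertex v).word := fun a ha =>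
      List.mem_append.2 ((List.mem_append.1 ha).imp_left (h a))
    rw [run, run, ← Category.assoc, wire_comp_step v h h'.1 hr.2.1 h'', Category.assoc, ih]

theorem run_comp_run {X Y Z : FreeCD G.signature} {L M : List G.V} (h : Runnable X L Z)
    (h' : Runnable Z M Y) (hr : Runnable X (L ++ M) Y) :
    run X L Z h ≫ run Z M Y h' = run X (L ++ M) Y hr := by
  induction L generalizing X with
  -- Here the first run is only the selection of `Z`, which the second run absorbs. This is why
  -- nothing need be kept between the two runs except `Z`.
  | nil => exact wire_comp_run _ _ _
  | cons v L ih =>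
    rw [run, Category.assoc, ih _ hr.2.2]
    rfl

theorem run_comp_wire_tensorHom_id {X P P' Q : FreeCD G.signature} {L : List G.V}
    (h : Runnable X L (P ⊗ Q)) (h' : ∀ a ∈ P'.word, a ∈ P.word) (hr : Runnable X L (P' ⊗ Q)) :
    run X L (P ⊗ Q) h ≫ (wire P P' h' ⊗ₘ 𝟙 Q) = run X L (P' ⊗ Q) hr := by
  induction L generalizing X with
  | nil => exact wire_tensor_comp_wire_tensorHom_id _ _ _ _ _ _
  | cons v L ih => rw [run, run, Category.assoc, ih]

theorem run_comp_braiding {X P Q : FreeCD G.signature} {L : List G.V}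
    (h : Runnable X L (P ⊗ Q)) (hr : Runnable X L (Q ⊗ P)) :
    run X L (P ⊗ Q) h ≫ (β_ P Q).hom = run X L (Q ⊗ P) hr := by
  induction L generalizing X with
  | nil => exact wire_tensor_comp_braiding _ _ _ _
  | cons v L ih => rw [run, run, Category.assoc, ih]

theorem pair_fst_id (X Y : FreeCD G.signature) :
    pair (fst X Y) (𝟙 (X ⊗ Y)) = (Δ[X] ⊗ₘ 𝟙 Y) ≫ (α_ X X Y).hom := by
  have h : pair (fst X Y) (fst X Y) = fst X Y ≫ Δ[X] := (IsComonHom.hom_comul _).symm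
  rw [← pair_fst_snd, ← pair_comp_associator, h, ← Category.comp_id (snd X Y),
    ← pair_comp_tensorHom, pair_fst_snd, Category.id_comp]

/-- A step leaves `X` untouched, so `X` may be copied before or after it. Only the old wires are
duplicated, never the output of the generator, so coassociativity suffices. -/
theorem step_comp_pair_fst {X Y : FreeCD G.signature} {v : G.V}
    (h : ∀ a ∈ (G.ob (G.parents v)).word, a ∈ X.word) (f : X ⊗ G.vertex v ⟶ Y) :
    step X v h ≫ pair (fst X (G.vertex v)) f = pair (𝟙 X) (step X v h ≫ f) := by
  have h₁ : pair (fst X (G.vertex v)) f = pair (fst X (G.vertex v)) (𝟙 _) ≫ (𝟙 X ⊗ₘ f) := by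
    rw [pair_comp_tensorHom, Category.comp_id, Category.id_comp]
  have h₂ : Δ[X] = pair (𝟙 X) (𝟙 X) := by simp [pair]
  have h₃ : pair (𝟙 X) (step X v h ≫ f) = pair (𝟙 X) (step X v h) ≫ (𝟙 X ⊗ₘ f) := by
    rw [pair_comp_tensorHom, Category.comp_id]
  rw [h₁, h₃, pair_fst_id, ← Category.assoc]
  congr 1
  rw [step, reassoc_of% @pair_comp_tensorHom, Category.id_comp, Category.comp_id, h₂,
    pair_comp_associator]

/-- A run can be duplicated together with its initial state: it may also be applied to a copy. -/
theorem pair_id_run {X B : FreeCD G.signature} {L : List G.V} (hX : X.word.Nodup)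
    (h : Runnable X L B) (hr : Runnable X L (X ⊗ B)) :
    pair (𝟙 X) (run X L B h) = run X L (X ⊗ B) hr := by
  induction L generalizing X with
  | nil =>
    rw [← wire_self X hX fun _ ha => ha]
    exact (wire_tensor X X B hr).symm
  | cons v L ih =>
    have hXv : (X ⊗ G.vertex v).word.Nodup := by
      refine List.nodup_append.2 ⟨hX, List.nodup_singleton v, fun a ha b hb e => h.2.1 ?_⟩
      rwa [← mem_vertex.1 hb, ← e]
    have h' : Runnable (X ⊗ G.vertex v) L ((X ⊗ G.vertex v) ⊗ B) :=
      h.2.2.of_mem fun a ha => (mem_tensor.1 ha).elim Or.inl (h.2.2.mem a)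
    have e : wire (X ⊗ G.vertex v) X (fun a ha => List.mem_append_left _ ha) =
        fst X (G.vertex v) := by
      rw [← fst_comp_wire X (G.vertex v) X fun _ ha => ha, wire_self X hX, Category.comp_id]
    -- The induction hypothesis keeps the enlarged state with `v` included; the surplus wire `v` is
    -- then dropped from the kept copy.
    rw [run, run, ← run_comp_wire_tensorHom_id h' (fun a ha => List.mem_append_left _ ha),
      ← ih hXv h.2.2, e, pair_comp_tensorHom, Category.id_comp, Category.comp_id,
      step_comp_pair_fst]

theorem pair_run_id {X B : FreeCD G.signature} {L : List G.V} (hX : X.word.Nodup)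
    (h : Runnable X L B) (hr : Runnable X L (B ⊗ X)) :
    pair (run X L B h) (𝟙 X) = run X L (B ⊗ X) hr := by
  have h' : Runnable X L (X ⊗ B) := h.of_mem fun a ha => (mem_tensor.1 ha).elim Or.inl (h.mem a)
  rw [← pair_comp_braiding, pair_id_run hX h h', run_comp_braiding]

/-- The part of the recursion for `copyComp` that adds the largest vertex is a run of length one:
wires outside `P` can be kept until the final selection. -/
theorem wire_comp_vertexGen_comp_wire {Z P Y : FreeCD G.signature} {v : G.V}
    (h : ∀ a ∈ (P ⊗ G.ob (G.parents v)).word, a ∈ Z.word)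
    (h' : ∀ a ∈ Y.word, a ∈ (P ⊗ G.vertex v).word) (hr : Runnable Z [v] Y) :
    wire Z (P ⊗ G.ob (G.parents v)) h ≫ (𝟙 P ⊗ₘ G.vertexGen v) ≫ wire (P ⊗ G.vertex v) Y h' =
      run Z [v] Y hr := by
  have hv := hr.1
  have hP : ∀ a ∈ P.word, a ∈ Z.word := fun a ha => h a (List.mem_append_left _ ha)
  have h'' : ∀ a ∈ (P ⊗ G.vertex v).word, a ∈ (Z ⊗ G.vertex v).word := fun a ha =>
    List.mem_append.2 ((List.mem_append.1 ha).imp_left (hP a))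
  have e : pair (wire Z P hP) (wire Z _ hv ≫ G.vertexGen v) =
      step Z v hv ≫ wire (Z ⊗ G.vertex v) (P ⊗ G.vertex v) h'' := by
    rw [← wire_tensorHom_id Z P (G.vertex v) hP (List.nodup_singleton v), step, pair_comp_tensorHom,
      Category.id_comp, Category.comp_id]
    intro a ha
    rw [mem_vertex.1 ha]
    exact hr.2.1
  rw [wire_tensor, reassoc_of% @pair_comp_tensorHom, Category.comp_id, e, Category.assoc,
    wire_comp_wire]
  rfl

theorem runnable_sort {X Y : FreeCD G.signature} {S : Finset G.V}
    (hX : ∀ v ∈ S, v ∉ X.word) (hp : ∀ v ∈ S, ∀ w, G.Edge w v → w ∈ X.word ∨ w ∈ S)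
    (hY : ∀ a ∈ Y.word, a ∈ X.word ∨ a ∈ S) : Runnable X S.sort Y :=
  runnable_of_pairwise S.sortedLT_sort.pairwise (by simpa using hX) (by simpa using hp)
    (by simpa using hY)

theorem runnable_inputs {S : Finset G.V} {X Y : FreeCD G.signature} (hX : ∀ v ∈ S, v ∉ X.word)
    (hp : ∀ v ∈ G.inputs S, v ∈ X.word)
    (hY : ∀ a ∈ Y.word, a ∈ X.word ∨ a ∈ S) : Runnable X S.sort Y := by
  refine runnable_sort hX (fun v hv w hw => ?_) hY
  by_cases h : w ∈ S
  · exact Or.inr h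
  · exact Or.inl (hp w (mem_inputs.2 ⟨⟨v, hv, hw⟩, h⟩))

theorem sort_eq_append_max' {S : Finset G.V} (h : S.Nonempty) :
    S.sort = (S.erase (S.max' h)).sort ++ [S.max' h] := by
  refine List.Perm.eq_of_pairwise (fun a b _ _ hab hba => (lt_asymm hab hba).elim)
    S.sortedLT_sort.pairwise ?_ ?_
  · refine List.pairwise_append.2 ⟨(S.erase _).sortedLT_sort.pairwise,
      List.pairwise_singleton _ _, fun a ha b hb => ?_⟩
    rw [List.mem_singleton.1 hb]
    rw [Finset.mem_sort] at ha
    exact S.lt_max'_of_mem_erase_max' h ha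
  · refine (List.perm_ext_iff_of_nodup (S.sort_nodup _) ?_).2 fun a => ?_
    · refine List.nodup_append.2 ⟨(S.erase _).sort_nodup _, List.nodup_singleton _, ?_⟩
      intro a ha b hb e
      rw [Finset.mem_sort] at ha
      exact (Finset.mem_erase.1 ha).1 (e.trans (List.mem_singleton.1 hb))
    · rw [List.mem_append, Finset.mem_sort, Finset.mem_sort, List.mem_singleton,
        Finset.mem_erase]
      have := S.max'_mem h
      constructor
      · tauto
      · rintro (h' | rfl)
        · exact h'.2
        · exact this

/-- In the recursion, the run for the smaller set may start from all inputs of `S` (`wire_comp_run`)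
and keep them (`pair_run_id`); the largest vertex is one more step at the end of the list. -/
theorem copyComp_eq_run (S : Finset G.V)
    (hr : Runnable (G.ob (G.inputs S)) S.sort (G.ob S)) :
    copyComp S = run (G.ob (G.inputs S)) S.sort (G.ob S) hr := by
  induction hn : S.card using Nat.strong_induction_on generalizing S with
  | _ n ih =>
  subst hn
  have nd : (G.ob (G.inputs S)).word.Nodup := Finset.sort_nodup _ _
  have fresh : ∀ v ∈ S, v ∉ (G.ob (G.inputs S)).word := fun v hv hv' =>
    (mem_inputs.1 (mem_ob.1 hv')).2 hv
  rw [copyComp]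
  split_ifs with h
  · set m := S.max' h with hm
    set S' := S.erase m with hS'
    have hin : ∀ v ∈ G.inputs S', v ∈ (G.ob (G.inputs S)).word := fun v hv =>
      wire_in_mem h v (mem_tensor.2 (Or.inl (mem_ob.2 hv)))
    have sub : ∀ v ∈ S', v ∈ S := fun v hv => Finset.mem_of_mem_erase hv
    have h₁ : Runnable (G.ob (G.inputs S')) S'.sort (G.ob S') :=
      runnable_inputs (fun v hv hv' => (mem_inputs.1 (mem_ob.1 hv')).2 hv)
        (fun v hv => mem_ob.2 hv) (fun a ha => Or.inr (mem_ob.1 ha))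
    have h₂ : Runnable (G.ob (G.inputs S)) S'.sort (G.ob S') :=
      runnable_inputs (fun v hv => fresh v (sub v hv)) hin (fun a ha => Or.inr (mem_ob.1 ha))
    have h₃ : Runnable (G.ob (G.inputs S)) S'.sort (G.ob S' ⊗ G.ob (G.inputs S)) :=
      h₂.of_mem fun a ha => (mem_tensor.1 ha).elim (h₂.mem a) Or.inl
    have h₄ : Runnable (G.ob S' ⊗ G.ob (G.inputs S)) [m] (G.ob S) := by
      refine ⟨fun a ha => wire_mid_mem h a (mem_tensor.2 (Or.inr ha)), fun hm' => ?_,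
        fun a ha => ?_⟩
      · rcases mem_tensor.1 hm' with hm' | hm'
        · exact (Finset.mem_erase.1 (mem_ob.1 hm')).1 rfl
        · exact fresh m (S.max'_mem h) hm'
      · have := wire_out_mem h a ha
        rw [mem_tensor] at this ⊢
        exact this.imp_left fun h => mem_tensor.2 (Or.inl h)
    have h₅ : Runnable (G.ob (G.inputs S)) (S'.sort ++ [m]) (G.ob S) := by
      rw [← sort_eq_append_max' h]
      exact hr
    rw [wire_comp_vertexGen_comp_wire _ _ h₄, wire_tensor, reassoc_of% @pair_comp_tensorHom,
      Category.comp_id, ih _ (Finset.card_erase_lt_of_mem (S.max'_mem h)) S' h₁ rfl,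
      wire_comp_run _ _ h₂, wire_self _ nd, pair_run_id nd _ h₃, run_comp_run _ _ h₅]
    congr 1
    exact (sort_eq_append_max' h).symm
  · obtain rfl := Finset.not_nonempty_iff_eq_empty.1 h
    -- The list is generalized so that the equation `sort ∅ = []` can be substituted in the type of
    -- the runnability proof.
    have key : ∀ (L : List G.V) (hL : L = [])
        (hr : Runnable (G.ob (G.inputs ∅)) L (G.ob ∅)),
        eqToHom ob_inputs_empty = run (G.ob (G.inputs ∅)) L (G.ob ∅) hr := by
      rintro L rfl hr
      exact eqToHom_eq_wire _ nd _
    exact key _ (Finset.sort_empty _) hr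

end ODAG

/-! ### Moving equalities of objects to the outside in strict monoidal categories. -/

section EqToHom

variable {D : Type u₂} [Category.{v₂} D] [MonoidalCategory D]

theorem eqToHom_comp_tensorHom {X Y Z X' Z' : D} (h : X = Y) (f : Y ⟶ Z) (g : X' ⟶ Z') :
    (eqToHom h ≫ f) ⊗ₘ g = eqToHom (congrArg (· ⊗ X') h) ≫ (f ⊗ₘ g) := by
  subst h
  simp

theorem comp_eqToHom_tensorHom {X Y Z X' Z' : D} (h : Y = Z) (f : X ⟶ Y) (g : X' ⟶ Z') :
    (f ≫ eqToHom h) ⊗ₘ g = (f ⊗ₘ g) ≫ eqToHom (congrArg (· ⊗ Z') h) := by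
  subst h
  simp

theorem tensorHom_eqToHom_comp {X Y Z X' Z' : D} (h : X = Y) (f : Y ⟶ Z) (g : X' ⟶ Z') :
    g ⊗ₘ (eqToHom h ≫ f) = eqToHom (congrArg (X' ⊗ ·) h) ≫ (g ⊗ₘ f) := by
  subst h
  simp

theorem tensorHom_comp_eqToHom {X Y Z X' Z' : D} (h : Y = Z) (f : X ⟶ Y) (g : X' ⟶ Z') :
    g ⊗ₘ (f ≫ eqToHom h) = (g ⊗ₘ f) ≫ eqToHom (congrArg (Z' ⊗ ·) h) := by
  subst h
  simp

section

variable [IsStrictMonoidal D]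

open IsStrictMonoidal

theorem associator_inv_eq (X Y Z : D) :
    (α_ X Y Z).inv = eqToHom (tensor_assoc X Y Z).symm := by
  rw [← cancel_epi (α_ X Y Z).hom, Iso.hom_inv_id, IsStrictMonoidal.associator_hom]
  simp

theorem tensorHom_tensorHom_eq {X Y Z X' Y' Z' : D} (f : X ⟶ X') (g : Y ⟶ Y') (h : Z ⟶ Z') :
    (f ⊗ₘ g) ⊗ₘ h = eqToHom (tensor_assoc X Y Z) ≫ (f ⊗ₘ (g ⊗ₘ h)) ≫
      eqToHom (tensor_assoc X' Y' Z').symm := by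
  rw [← associator_inv_eq, ← IsStrictMonoidal.associator_hom]
  simp

/-- The object `U` is merely equal to the unit because an interpretation sends the empty word to the
unit only up to propositional equality. -/
theorem id_tensorHom_eq {U X Y : D} (e : U = 𝟙_ D) (f : X ⟶ Y) :
    𝟙 U ⊗ₘ f = eqToHom ((congrArg (· ⊗ X) e).trans (unit_tensor X)) ≫ f ≫
      eqToHom ((congrArg (· ⊗ Y) e).trans (unit_tensor Y)).symm := by
  subst e
  have := leftUnitor_naturality f
  rw [leftUnitor_hom, leftUnitor_hom] at this
  rw [← reassoc_of% this]
  simp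

theorem tensorHom_id_eq {U X Y : D} (e : U = 𝟙_ D) (f : X ⟶ Y) :
    f ⊗ₘ 𝟙 U = eqToHom ((congrArg (X ⊗ ·) e).trans (tensor_unit X)) ≫ f ≫
      eqToHom ((congrArg (Y ⊗ ·) e).trans (tensor_unit Y)).symm := by
  subst e
  have := rightUnitor_naturality f
  rw [rightUnitor_hom, rightUnitor_hom] at this
  rw [← reassoc_of% this]
  simp

theorem leftUnitor_inv_eq (X : D) : (λ_ X).inv = eqToHom (unit_tensor X).symm := by
  rw [← cancel_epi (λ_ X).hom, Iso.hom_inv_id, leftUnitor_hom]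
  simp

theorem rightUnitor_inv_eq (X : D) : (ρ_ X).inv = eqToHom (tensor_unit X).symm := by
  rw [← cancel_epi (ρ_ X).hom, Iso.hom_inv_id, rightUnitor_hom]
  simp

end

variable [CopyDiscardCategory D]

section

variable [IsStrictMonoidal D]

open IsStrictMonoidal

theorem braiding_tensor_eq (X Y Z : D) :
    (β_ X (Y ⊗ Z)).hom = eqToHom (tensor_assoc X Y Z).symm ≫ ((β_ X Y).hom ⊗ₘ 𝟙 Z) ≫
      eqToHom (tensor_assoc Y X Z) ≫ (𝟙 Y ⊗ₘ (β_ X Z).hom) ≫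
        eqToHom (tensor_assoc Y Z X).symm := by
  rw [← associator_inv_eq, ← associator_inv_eq, ← IsStrictMonoidal.associator_hom, tensorHom_id,
    id_tensorHom, ← BraidedCategory.hexagon_forward_assoc]
  simp

theorem tensorμ_eq (X Y Z W : D) :
    tensorμ X Y Z W = eqToHom (by rw [tensor_assoc, tensor_assoc]) ≫
      (𝟙 X ⊗ₘ ((β_ Y Z).hom ⊗ₘ 𝟙 W)) ≫ eqToHom (by rw [tensor_assoc, tensor_assoc]) := by
  simp only [tensorμ, associator_inv_eq, IsStrictMonoidal.associator_hom, whiskerLeft_eqToHom,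
    eqToHom_trans, eqToHom_trans_assoc, id_tensorHom, tensorHom_id]

end

theorem copy_eqToHom {X Y : D} (h : X = Y) :
    Δ[X] = eqToHom h ≫ Δ[Y] ≫ eqToHom (congrArg₂ (· ⊗ ·) h h).symm := by
  subst h
  simp

theorem discard_eqToHom {X Y : D} (h : X = Y) : ε[X] = eqToHom h ≫ ε[Y] := by
  subst h
  simp

theorem braiding_eqToHom {X Y X' Y' : D} (h : X = X') (h' : Y = Y') :
    (β_ X Y).hom = eqToHom (congrArg₂ (· ⊗ ·) h h') ≫ (β_ X' Y').hom ≫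
      eqToHom (congrArg₂ (· ⊗ ·) h' h).symm := by
  subst h h'
  simp

end EqToHom

/-! ### The universal property of free CD-categories. -/

/-- An assignment of objects and morphisms of a CD-category to the words and the generating
morphisms of a signature, which is compatible with concatenation of words. -/
structure Interpretation (σ : MonoidalSignature.{u, w}) (D : Type u₂) [Category.{v₂} D]
    [MonoidalCategory D] where
  obj : List σ.Obj → D
  obj_nil : obj [] = 𝟙_ D
  obj_append : ∀ X Y, obj (X ++ Y) = obj X ⊗ obj Y
  gen : ∀ g : σ.Gen, obj (σ.dom g) ⟶ obj (σ.cod g)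

namespace Interpretation

variable {σ : MonoidalSignature.{u, w}} {D : Type u₂} [Category.{v₂} D] [MonoidalCategory D]
  [CopyDiscardCategory D] (I : Interpretation σ D)

/-- The interpretation of formal string diagrams. -/
def mapTerm : {X Y : List σ.Obj} → CDTerm σ X Y → (I.obj X ⟶ I.obj Y)
  | _, _, .gen g => I.gen g
  | _, _, .id X => 𝟙 (I.obj X)
  | _, _, .comp f g => mapTerm f ≫ mapTerm g
  | _, _, .tensor f g =>
    eqToHom (I.obj_append _ _) ≫ (mapTerm f ⊗ₘ mapTerm g) ≫ eqToHom (I.obj_append _ _).symm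
  | _, _, .braid X Y =>
    eqToHom (I.obj_append X Y) ≫ (β_ (I.obj X) (I.obj Y)).hom ≫ eqToHom (I.obj_append Y X).symm
  | _, _, .copy X => Δ[I.obj X] ≫ eqToHom (I.obj_append X X).symm
  | _, _, .del X => ε[I.obj X] ≫ eqToHom I.obj_nil.symm

theorem mapTerm_castId {X Y : List σ.Obj} (h : X = Y) :
    I.mapTerm (CDTerm.castId h) = eqToHom (congrArg I.obj h) := by
  subst h
  rfl

/-- Soundness: each defining law holds in every strict CD-category. Once the transports are moved
outward and merged, what remains is the corresponding law of `D`. -/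
theorem mapTerm_eq_of_rel [IsStrictMonoidal D] {X Y : List σ.Obj} {f g : CDTerm σ X Y}
    (h : CDTerm.Rel f g) : I.mapTerm f = I.mapTerm g := by
  induction h with
  | refl => rfl
  | symm _ ih => exact ih.symm
  | trans _ _ ih₁ ih₂ => exact ih₁.trans ih₂
  | comp_congr _ _ ih₁ ih₂ => simp only [mapTerm, ih₁, ih₂]
  | tensor_congr _ _ ih₁ ih₂ => simp only [mapTerm, ih₁, ih₂]
  | id_comp f => exact Category.id_comp _
  | comp_id f => exact Category.comp_id _
  | assoc f g h => exact Category.assoc _ _ _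
  | id_tensor_id X Y => simp [mapTerm]
  | tensor_comp f f' g g' => simp [mapTerm]
  | tensor_assoc f₁ f₂ f₃ =>
    simp only [mapTerm, mapTerm_castId, eqToHom_comp_tensorHom, comp_eqToHom_tensorHom,
      tensorHom_eqToHom_comp, tensorHom_comp_eqToHom, tensorHom_tensorHom_eq, eqToHom_trans,
      eqToHom_trans_assoc, Category.assoc]
  | unit_tensor f =>
    simp only [mapTerm, mapTerm_castId, id_tensorHom_eq I.obj_nil, eqToHom_trans,
      eqToHom_trans_assoc, Category.assoc, eqToHom_refl, Category.comp_id]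
  | tensor_unit f =>
    simp only [mapTerm, mapTerm_castId, tensorHom_id_eq I.obj_nil, eqToHom_trans,
      eqToHom_trans_assoc, Category.assoc, eqToHom_refl, Category.comp_id]
  | braid_natural f f' =>
    simp [mapTerm, BraidedCategory.braiding_naturality_assoc]
  | braid_braid X Y => simp [mapTerm]
  | hexagon X Y Z =>
    simp only [mapTerm, mapTerm_castId, eqToHom_comp_tensorHom, comp_eqToHom_tensorHom,
      tensorHom_eqToHom_comp, tensorHom_comp_eqToHom, eqToHom_trans,
      eqToHom_trans_assoc, Category.assoc, braiding_eqToHom rfl (I.obj_append Y Z),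
      braiding_tensor_eq]
  | copy_comm X => simp [mapTerm]
  | copy_assoc X =>
    have := ComonObj.comul_assoc (I.obj X)
    rw [IsStrictMonoidal.associator_hom, ← tensorHom_id, ← id_tensorHom] at this
    simp only [mapTerm, mapTerm_castId, comp_eqToHom_tensorHom, tensorHom_comp_eqToHom,
      eqToHom_trans, eqToHom_trans_assoc, Category.assoc, eqToHom_refl, Category.id_comp,
      reassoc_of% this]
  | copy_del_left X =>
    simp only [mapTerm, mapTerm_castId, comp_eqToHom_tensorHom, eqToHom_trans,
      eqToHom_trans_assoc, Category.assoc, ComonObj.counit_comul_hom_assoc, leftUnitor_inv_eq,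
      Category.id_comp, eqToHom_refl]
    rfl
  | copy_del_right X =>
    simp only [mapTerm, mapTerm_castId, tensorHom_comp_eqToHom, eqToHom_trans,
      eqToHom_trans_assoc, Category.assoc, ComonObj.comul_counit_hom_assoc, rightUnitor_inv_eq,
      Category.id_comp, eqToHom_refl]
  | copy_append X Y =>
    simp only [mapTerm, mapTerm_castId, copy_eqToHom (I.obj_append X Y),
      CopyDiscardCategory.copy_tensor, tensorμ_eq, eqToHom_comp_tensorHom, comp_eqToHom_tensorHom,
      tensorHom_eqToHom_comp, tensorHom_comp_eqToHom, eqToHom_trans, eqToHom_trans_assoc,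
      Category.assoc]
  | copy_nil =>
    simp only [mapTerm, mapTerm_castId, copy_eqToHom I.obj_nil, CopyDiscardCategory.copy_unit,
      leftUnitor_inv_eq, eqToHom_trans]
  | del_append X Y =>
    simp only [mapTerm, mapTerm_castId, discard_eqToHom (I.obj_append X Y),
      CopyDiscardCategory.discard_tensor, IsStrictMonoidal.leftUnitor_hom,
      comp_eqToHom_tensorHom, tensorHom_comp_eqToHom, eqToHom_trans, Category.assoc]
  | del_nil =>
    simp only [mapTerm, discard_eqToHom I.obj_nil, CopyDiscardCategory.discard_unit,
      Category.comp_id, eqToHom_trans, eqToHom_refl]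

/-- The CD-functor out of a free CD-category that is determined by an interpretation of the
signature. -/
def lift [IsStrictMonoidal D] : CDFunctor (FreeCD σ) D where
  obj X := I.obj X.word
  map := Quotient.lift I.mapTerm fun _ _ => I.mapTerm_eq_of_rel
  map_id _ := rfl
  map_comp := by
    rintro _ _ _ ⟨f⟩ ⟨g⟩
    rfl
  obj_unit := I.obj_nil
  obj_tensor X Y := I.obj_append X.word Y.word
  map_tensor := by
    rintro _ _ _ _ ⟨f⟩ ⟨g⟩
    rfl
  map_braiding _ _ := rfl
  map_copy _ := rfl
  map_del _ := rfl

end Interpretation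

/-- CD-functors out of a free CD-category are equal if they agree on generating objects and
morphisms. -/
theorem CDFunctor.ext_of_gen {σ : MonoidalSignature.{u, w}} {D : Type u₂} [Category.{v₂} D]
    [MonoidalCategory D] [CopyDiscardCategory D] {Φ Ψ : CDFunctor (FreeCD σ) D}
    (hobj : ∀ X, Φ.obj X = Ψ.obj X)
    (hgen : ∀ g : σ.Gen, Φ.map (FreeCD.gen g) =
      eqToHom (hobj _) ≫ Ψ.map (FreeCD.gen g) ≫ eqToHom (hobj _).symm) : Φ = Ψ := by
  have key : ∀ {X Y : List σ.Obj} (f : CDTerm σ X Y), Φ.map (FreeCD.homMk f) =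
      eqToHom (hobj ⟨X⟩) ≫ Ψ.map (FreeCD.homMk f) ≫ eqToHom (hobj ⟨Y⟩).symm := by
    intro X Y f
    induction f with
    | gen g => exact hgen g
    | id X => simp [FreeCD.homMk_id]
    | comp f g ihf ihg =>
      rw [FreeCD.homMk_comp, Functor.map_comp, Functor.map_comp, ihf, ihg]
      simp
    | tensor f g ihf ihg =>
      rw [FreeCD.homMk_tensor, Φ.map_tensor, Ψ.map_tensor, ihf, ihg]
      simp only [eqToHom_comp_tensorHom, comp_eqToHom_tensorHom,
        tensorHom_eqToHom_comp, tensorHom_comp_eqToHom, eqToHom_trans, eqToHom_trans_assoc,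
        Category.assoc]
    | braid X Y =>
      refine (Φ.map_braiding ⟨X⟩ ⟨Y⟩).trans ?_
      refine Eq.trans ?_ (congrArg (_ ≫ · ≫ _) (Ψ.map_braiding ⟨X⟩ ⟨Y⟩).symm)
      rw [braiding_eqToHom (hobj ⟨X⟩) (hobj ⟨Y⟩)]
      simp only [eqToHom_trans, eqToHom_trans_assoc, Category.assoc]
    | copy X =>
      refine (Φ.map_copy ⟨X⟩).trans ?_
      refine Eq.trans ?_ (congrArg (_ ≫ · ≫ _) (Ψ.map_copy ⟨X⟩).symm)
      rw [copy_eqToHom (hobj ⟨X⟩)]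
      simp only [eqToHom_trans, Category.assoc]
    | del X =>
      refine (Φ.map_del ⟨X⟩).trans ?_
      refine Eq.trans ?_ (congrArg (_ ≫ · ≫ _) (Ψ.map_del ⟨X⟩).symm)
      rw [discard_eqToHom (hobj ⟨X⟩)]
      simp only [eqToHom_trans, Category.assoc]
  refine CDFunctor.ext' (CategoryTheory.Functor.ext hobj ?_)
  rintro X Y ⟨f⟩
  exact key f

/-- Transports of one morphism along different equalities match after transport of their endpoints;
this reconciles two descriptions of the same value on a generator. -/
theorem conj_eqToHom_eq {C : Type u} [Category.{v} C] {A A' B B' X Y : C} (f : X ⟶ Y)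
    (h₁ : A = X) (h₂ : A' = X) (h₃ : Y = B) (h₄ : Y = B') (h₅ : A = A') (h₆ : B' = B) :
    eqToHom h₁ ≫ f ≫ eqToHom h₃ =
      eqToHom h₅ ≫ (eqToHom h₂ ≫ f ≫ eqToHom h₄) ≫ eqToHom h₆ := by
  subst h₁ h₅ h₃ h₄
  simp

namespace CDFunctor

open CopyDiscardCategory

variable {C : Type u₁} [Category.{v₁} C] [MonoidalCategory C] [CopyDiscardCategory C]
  {D : Type u₂} [Category.{v₂} D] [MonoidalCategory D] [CopyDiscardCategory D]

theorem map_pair (Φ : CDFunctor C D) {X Y Z : C} (f : X ⟶ Y) (g : X ⟶ Z) :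
    Φ.map (pair f g) = pair (Φ.map f) (Φ.map g) ≫ eqToHom (Φ.obj_tensor Y Z).symm := by
  rw [pair, pair, Functor.map_comp, Φ.map_copy, Φ.map_tensor]
  simp only [Category.assoc, eqToHom_trans_assoc, eqToHom_refl, Category.id_comp]

end CDFunctor

/-! ### The preimage functor of a morphism of ordered DAGs and its action on runs. -/

namespace ODAG

open CopyDiscardCategory FreeCD

variable {G G' G'' : ODAG.{u}}

theorem run_comp_eqToHom {X Y Y' : FreeCD G.signature} {L : List G.V} (e : Y = Y')
    (h : Runnable X L Y) : run X L Y h ≫ eqToHom e = run X L Y' (e ▸ h) := by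
  subst e
  exact Category.comp_id _

theorem run_congr {X X' Y Y' : FreeCD G.signature} {L L' : List G.V} (hX : X = X') (hL : L = L')
    (hY : Y = Y') (h : Runnable X L Y) (h' : Runnable X' L' Y') :
    run X L Y h = eqToHom hX ≫ run X' L' Y' h' ≫ eqToHom hY.symm := by
  subst hX hL hY
  simp

theorem mem_pullObj_word {α : G ⟶ G'} {X : FreeCD G'.signature} {w : G.V} :
    w ∈ (pullObj α X).word ↔ α.toFun w ∈ X.word := by
  refine List.mem_flatMap.trans ?_
  simp [mem_preimage]

theorem nodup_pullObj (α : G ⟶ G') {X : FreeCD G'.signature} (hX : X.word.Nodup) :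
    (pullObj α X).word.Nodup := by
  refine List.nodup_flatMap.2 ⟨fun _ _ => Finset.sort_nodup _ _, hX.imp fun hab x hx hy => ?_⟩
  rw [Finset.mem_sort, mem_preimage] at hx hy
  exact hab (hx.symm.trans hy)

/-- Edges are mapped to edges or collapsed, so a parent of a vertex over `v` lies over `v` or over a
parent of `v`. In the second case it is available in the pulled back state. -/
theorem runnable_preimage (α : G ⟶ G') {X : FreeCD G'.signature} {Y : FreeCD G.signature}
    {v : G'.V} (hX : ∀ a ∈ (G'.ob (G'.parents v)).word, a ∈ X.word) (hv : v ∉ X.word)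
    (hY : ∀ a ∈ Y.word, a ∈ (pullObj α X).word ∨ a ∈ preimage α v) :
    Runnable (pullObj α X) (preimage α v).sort Y := by
  refine runnable_inputs (fun w hw hw' => hv ?_) (fun w hw => ?_) hY
  · rw [← mem_preimage.1 hw]
    exact mem_pullObj_word.1 hw'
  · have := mem_pullObj.1 (wire_pull_mem α v w (mem_ob.2 hw))
    exact mem_pullObj_word.2 (hX _ (mem_ob.2 this))

theorem not_mem_ob_parents (v : G.V) : v ∉ (G.ob (G.parents v)).word := fun h =>
  (G.lt_of_edge (mem_parents.1 (mem_ob.1 h))).false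

theorem runnable_pullGen (α : G ⟶ G') (v : G'.V) :
    Runnable (pullObj α (G'.ob (G'.parents v))) (preimage α v).sort (G.ob (preimage α v)) :=
  runnable_preimage α (fun _ ha => ha) (not_mem_ob_parents v) fun _ ha => Or.inr (mem_ob.1 ha)

theorem pullGen_eq_run (α : G ⟶ G') (v : G'.V) :
    pullGen α v = run (pullObj α (G'.ob (G'.parents v))) (preimage α v).sort
      (G.ob (preimage α v)) (runnable_pullGen α v) := by
  have hr : Runnable (G.ob (G.inputs (preimage α v))) (preimage α v).sort
      (G.ob (preimage α v)) :=
    runnable_inputs (fun w hw hw' => (mem_inputs.1 (mem_ob.1 hw')).2 hw)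
      (fun w hw => mem_ob.2 hw) (fun a ha => Or.inr (mem_ob.1 ha))
  rw [pullGen, copyComp_eq_run _ hr, wire_comp_run]

/-- Preimages, as an interpretation of the signature of `G'` in the syntax category of `G`. -/
noncomputable def interpretation (α : G ⟶ G') :
    Interpretation G'.signature (FreeCD G.signature) where
  obj L := pullObj α ⟨L⟩
  obj_nil := rfl
  obj_append _ _ := congrArg FreeCD.mk List.flatMap_append
  gen v := pullGen α v ≫ eqToHom (pullObj_vertex α v).symm

/-- The CD-functor between syntax categories that is induced by a morphism of ordered DAGs. -/
noncomputable def pullback (α : G ⟶ G') :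
    CDFunctor (FreeCD G'.signature) (FreeCD G.signature) :=
  (interpretation α).lift

theorem pullback_map_vertexGen (α : G ⟶ G') (v : G'.V) :
    (pullback α).map (G'.vertexGen v) = pullGen α v ≫ eqToHom (pullObj_vertex α v).symm := rfl

theorem isPreimageFunctor_pullback (α : G ⟶ G') : IsPreimageFunctor α (pullback α) where
  obj_eq _ := rfl
  map_gen v := (pullback_map_vertexGen α v).trans (Category.id_comp _).symm

/-- Besides uniqueness in the theorem, this yields both functor laws: each equates two CD-functors
with the same prescribed values. -/
theorem IsPreimageFunctor.eq {α : G ⟶ G'}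
    {Φ Ψ : CDFunctor (FreeCD G'.signature) (FreeCD G.signature)} (hΦ : IsPreimageFunctor α Φ)
    (hΨ : IsPreimageFunctor α Ψ) : Φ = Ψ := by
  refine CDFunctor.ext_of_gen (fun X => (hΦ.obj_eq X).trans (hΨ.obj_eq X).symm) fun v => ?_
  refine (hΦ.map_gen v).trans ?_
  refine Eq.trans ?_ (congrArg (eqToHom _ ≫ · ≫ eqToHom _) (hΨ.map_gen v).symm)
  exact conj_eqToHom_eq _ _ _ _ _ _ _

theorem pullObj_tensor (α : G ⟶ G') (X Y : FreeCD G'.signature) :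
    pullObj α (X ⊗ Y) = pullObj α X ⊗ pullObj α Y := (pullback α).obj_tensor X Y

/-- The action of `pullback α` on morphisms. -/
noncomputable def pullMap (α : G ⟶ G') {X Y : FreeCD G'.signature} (f : X ⟶ Y) :
    pullObj α X ⟶ pullObj α Y := (pullback α).map f

theorem pullMap_id (α : G ⟶ G') (X : FreeCD G'.signature) : pullMap α (𝟙 X) = 𝟙 _ := rfl

theorem pullMap_comp (α : G ⟶ G') {X Y Z : FreeCD G'.signature} (f : X ⟶ Y) (g : Y ⟶ Z) :
    pullMap α (f ≫ g) = pullMap α f ≫ pullMap α g := (pullback α).map_comp f g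

theorem pullMap_eqToHom (α : G ⟶ G') {X Y : FreeCD G'.signature} (e : X = Y) :
    pullMap α (eqToHom e) = eqToHom (congrArg (pullObj α) e) := eqToHom_map (pullback α).toFunctor e

theorem pullMap_tensorHom (α : G ⟶ G') {X X' Y Y' : FreeCD G'.signature} (f : X ⟶ X')
    (g : Y ⟶ Y') : pullMap α (f ⊗ₘ g) = eqToHom (pullObj_tensor α X Y) ≫
      (pullMap α f ⊗ₘ pullMap α g) ≫ eqToHom (pullObj_tensor α X' Y').symm :=
  (pullback α).map_tensor f g

theorem pullMap_pair (α : G ⟶ G') {X Y Z : FreeCD G'.signature} (f : X ⟶ Y) (g : X ⟶ Z) :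
    pullMap α (pair f g) =
      pair (pullMap α f) (pullMap α g) ≫ eqToHom (pullObj_tensor α Y Z).symm :=
  (pullback α).map_pair f g

theorem pullMap_discard (α : G ⟶ G') (X : FreeCD G'.signature) :
    pullMap α ε[X] = ε[pullObj α X] := Category.comp_id _

theorem pullMap_vertexGen (α : G ⟶ G') (v : G'.V) :
    pullMap α (G'.vertexGen v) = pullGen α v ≫ eqToHom (pullObj_vertex α v).symm := rfl

/-- Fibres over different vertices are disjoint, so deleting the blocks before the first occurrence
of `a` does not affect the labels over `a`, and their first occurrences form exactly the first block
over `a`. -/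
theorem pullMap_proj (α : G ⟶ G') (X : FreeCD G'.signature) (a : G'.V) (h : a ∈ X.word)
    (h' : ∀ w ∈ (pullObj α ⟨[a]⟩).word, w ∈ (pullObj α X).word) :
    pullMap α (proj X.word a h) = wire (pullObj α X) (pullObj α ⟨[a]⟩) h' := by
  induction X using word_induction with
  | unit => exact absurd h List.not_mem_nil
  | cons x X ih =>
    have e := pullObj_tensor α ⟨[x]⟩ X
    have hw : ∀ w ∈ (pullObj α ⟨[a]⟩).word,
        w ∈ (pullObj α ⟨[x]⟩ ⊗ pullObj α X).word := fun w hw => e ▸ h' w hw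
    rw [← eqToHom_comp_wire e _ hw]
    by_cases ea : a = x
    · subst ea
      have e₁ : pullMap α (𝟙 (⟨[a]⟩ : FreeCD G'.signature) ⊗ₘ ε[X]) =
          eqToHom e ≫ (𝟙 (pullObj α ⟨[a]⟩) ⊗ₘ ε[pullObj α X]) ≫ (ρ_ _).hom := by
        rw [pullMap_tensorHom, pullMap_id, pullMap_discard, IsStrictMonoidal.rightUnitor_hom]
        rfl
      rw [← fst_comp_wire _ _ _ fun _ hw => hw,
        wire_self _ (nodup_pullObj α (List.nodup_singleton a)), fst, Category.comp_id, ← e₁]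
      exact congrArg (pullMap α) (proj_cons_self (σ := G'.signature) a X h)
    · have h₁ : a ∈ X.word := List.mem_of_ne_of_mem ea h
      have hX : ∀ w ∈ (pullObj α ⟨[a]⟩).word, w ∈ (pullObj α X).word := fun w hw => by
        rw [mem_pullObj_word] at hw ⊢
        rwa [List.mem_singleton.1 hw]
      have hx : ∀ w ∈ (pullObj α ⟨[a]⟩).word, w ∉ (pullObj α ⟨[x]⟩).word := by
        intro w hw hw'
        rw [mem_pullObj_word, List.mem_singleton] at hw hw'
        exact ea (hw.symm.trans hw')
      have e₁ : pullMap α (ε[(⟨[x]⟩ : FreeCD G'.signature)] ⊗ₘ proj X.word a h₁) =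
          eqToHom e ≫ (ε[pullObj α ⟨[x]⟩] ⊗ₘ wire (pullObj α X) (pullObj α ⟨[a]⟩) hX) ≫
            (λ_ _).hom := by
        rw [pullMap_tensorHom, pullMap_discard, ih h₁ hX, IsStrictMonoidal.leftUnitor_hom]
        rfl
      rw [← snd_comp_wire _ _ _ hX hx, snd, Category.assoc, ← leftUnitor_naturality,
        ← id_tensorHom, tensorHom_comp_tensorHom_assoc, Category.comp_id, Category.id_comp, ← e₁]
      exact congrArg (pullMap α) (proj_cons_of_ne ea X h h₁)

theorem pullMap_wire (α : G ⟶ G') (X Y : FreeCD G'.signature)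
    (h : ∀ a ∈ Y.word, a ∈ X.word) (h' : ∀ w ∈ (pullObj α Y).word, w ∈ (pullObj α X).word) :
    pullMap α (wire X Y h) = wire (pullObj α X) (pullObj α Y) h' := by
  induction Y using word_induction with
  | unit => exact pullMap_discard α X
  | cons a Y ih =>
    have ha : ∀ w ∈ (pullObj α ⟨[a]⟩).word, w ∈ (pullObj α X).word := fun w hw =>
      mem_pullObj_word.2 (List.mem_singleton.1 (mem_pullObj_word.1 hw) ▸ h a List.mem_cons_self)
    have hY : ∀ w ∈ (pullObj α Y).word, w ∈ (pullObj α X).word := fun w hw =>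
      mem_pullObj_word.2 (h _ (List.mem_cons_of_mem a (mem_pullObj_word.1 hw)))
    have ht : ∀ w ∈ (pullObj α ⟨[a]⟩ ⊗ pullObj α Y).word, w ∈ (pullObj α X).word :=
      fun w hw => (mem_tensor.1 hw).elim (ha w) (hY w)
    rw [wire_cons, pullMap_pair, ih _ hY, pullMap_proj α X a _ ha, ← wire_tensor _ _ _ ht,
      wire_comp_eqToHom]

/-- The image keeps one copy of the state and runs the fibre of `v` on another. By `pair_id_run`
this equals running the fibre on the state itself, although the generators involved cannot be
copied. -/
theorem pullMap_step (α : G ⟶ G') (X : FreeCD G'.signature) (hX : X.word.Nodup) (v : G'.V)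
    (h : ∀ a ∈ (G'.ob (G'.parents v)).word, a ∈ X.word) (hv : v ∉ X.word)
    (hr : Runnable (pullObj α X) (preimage α v).sort (pullObj α (X ⊗ G'.vertex v))) :
    pullMap α (step X v h) =
      run (pullObj α X) (preimage α v).sort (pullObj α (X ⊗ G'.vertex v)) hr := by
  have h₁ : ∀ w ∈ (pullObj α (G'.ob (G'.parents v))).word, w ∈ (pullObj α X).word := fun w hw =>
    mem_pullObj_word.2 (h _ (mem_pullObj_word.1 hw))
  have h₂ : Runnable (pullObj α X) (preimage α v).sort (G.ob (preimage α v)) :=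
    runnable_preimage α h hv fun _ ha => Or.inr (mem_ob.1 ha)
  have h₃ : Runnable (pullObj α X) (preimage α v).sort (pullObj α (G'.vertex v)) :=
    pullObj_vertex α v ▸ h₂
  have h₄ : Runnable (pullObj α X) (preimage α v).sort (pullObj α X ⊗ pullObj α (G'.vertex v)) :=
    pullObj_tensor α X (G'.vertex v) ▸ hr
  rw [step, pullMap_pair, pullMap_comp, pullMap_wire α _ _ _ h₁, pullMap_vertexGen,
    pullGen_eq_run, run_comp_eqToHom, wire_comp_run _ _ h₃, pullMap_id,
    pair_id_run (nodup_pullObj α hX) _ h₄, run_comp_eqToHom]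

theorem Runnable.pull (α : G ⟶ G') {X Y : FreeCD G'.signature} {L : List G'.V}
    (h : Runnable X L Y) :
    Runnable (pullObj α X) (L.flatMap fun v => (preimage α v).sort) (pullObj α Y) := by
  induction L generalizing X with
  | nil => exact fun w hw => mem_pullObj_word.2 (h _ (mem_pullObj_word.1 hw))
  | cons v L ih =>
    have e : pullObj α (X ⊗ G'.vertex v) = pullObj α X ⊗ G.ob (preimage α v) := by
      rw [← pullObj_vertex, pullObj_tensor]
    refine Runnable.append (runnable_preimage α h.1 h.2.1 fun a ha => ?_) ?_
    · exact (mem_tensor.1 ha).imp_right mem_ob.1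
    · have := ih h.2.2
      rwa [e] at this

theorem pullMap_run (α : G ⟶ G') {X Y : FreeCD G'.signature} {L : List G'.V}
    (hX : X.word.Nodup) (h : Runnable X L Y) :
    pullMap α (run X L Y h) =
      run (pullObj α X) (L.flatMap fun v => (preimage α v).sort) (pullObj α Y) (h.pull α) := by
  induction L generalizing X with
  | nil => exact pullMap_wire α _ _ _ _
  | cons v L ih =>
    have hXv : (X ⊗ G'.vertex v).word.Nodup := by
      refine List.nodup_append.2 ⟨hX, List.nodup_singleton v, fun a ha b hb e => h.2.1 ?_⟩
      rwa [← mem_vertex.1 hb, ← e]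
    have hr : Runnable (pullObj α X) (preimage α v).sort (pullObj α (X ⊗ G'.vertex v)) := by
      refine runnable_preimage α h.1 h.2.1 fun a ha => ?_
      rw [mem_pullObj_word, mem_tensor, mem_vertex] at ha
      rwa [mem_pullObj_word, mem_preimage]
    rw [run, pullMap_comp, ih hXv h.2.2, pullMap_step α X hX v h.1 h.2.1 hr]
    exact run_comp_run _ _ _

/-! ### Compatibility with composition and identities. -/

/-- Monotonicity of `α` puts the fibre over a smaller vertex entirely before the fibre over a larger
one, so the concatenation is again strictly increasing and has the right members. -/
theorem flatMap_preimage_sort (α : G ⟶ G') (β : G' ⟶ G'') (v : G''.V) :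
    ((preimage β v).sort.flatMap fun x => (preimage α x).sort) = (preimage (α ≫ β) v).sort := by
  refine List.Perm.eq_of_pairwise (fun a b _ _ hab hba => (lt_asymm hab hba).elim)
    (List.pairwise_flatMap.2 ⟨fun x _ => (Finset.sortedLT_sort _).pairwise,
      (Finset.sortedLT_sort _).pairwise.imp fun hab x hx y hy => ?_⟩)
    (Finset.sortedLT_sort _).pairwise
    ((List.perm_ext_iff_of_nodup ?_ (Finset.sort_nodup _ _)).2 fun a => ?_)
  · rw [Finset.mem_sort, mem_preimage] at hx hy
    subst hx hy
    exact α.monotone.reflect_lt hab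
  · exact nodup_pullObj α (X := G'.ob (preimage β v)) (Finset.sort_nodup _ _)
  · simp only [List.mem_flatMap, Finset.mem_sort, mem_preimage, exists_eq_right']
    rfl

theorem pullObj_comp (α : G ⟶ G') (β : G' ⟶ G'') (X : FreeCD G''.signature) :
    pullObj α (pullObj β X) = pullObj (α ≫ β) X := by
  refine congrArg FreeCD.mk ?_
  change (X.word.flatMap _).flatMap _ = X.word.flatMap _
  rw [List.flatMap_assoc]
  simp only [flatMap_preimage_sort]

theorem isPreimageFunctor_comp (α : G ⟶ G') (β : G' ⟶ G'') :
    IsPreimageFunctor (α ≫ β) ((pullback β).comp (pullback α)) where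
  obj_eq X := pullObj_comp α β X
  map_gen v := by
    have nd : (pullObj β (G''.ob (G''.parents v))).word.Nodup :=
      nodup_pullObj β (Finset.sort_nodup _ _)
    have e : pullObj α (G'.ob (preimage β v)) = G.ob (preimage (α ≫ β) v) :=
      congrArg FreeCD.mk (flatMap_preimage_sort α β v)
    change pullMap α (pullMap β (G''.vertexGen v)) = _
    rw [pullMap_vertexGen, pullMap_comp, pullMap_eqToHom, pullGen_eq_run, pullMap_run α nd,
      pullGen_eq_run,
      -- Both sides are now runs whose initial words, vertex lists and final words agree up to
      -- propositional equality.
      run_congr (pullObj_comp α β _) (flatMap_preimage_sort α β v) e _ (runnable_pullGen _ v)]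
    simp only [Category.assoc, eqToHom_trans]
    rfl

theorem preimage_id (v : G.V) : preimage (𝟙 G) v = {v} := by
  ext w
  rw [mem_preimage, Finset.mem_singleton]
  rfl

theorem pullObj_id (X : FreeCD G.signature) : pullObj (𝟙 G) X = X := by
  refine congrArg FreeCD.mk ?_
  simp [preimage_id]

/-- The parents kept by the step are deleted by the final selection, so the counit law leaves the
bare generator. Hence the identity functor has the values prescribed for the identity map. -/
theorem run_singleton (v : G.V) (h : Runnable (G.ob (G.parents v)) [v] (G.vertex v)) :
    run (G.ob (G.parents v)) [v] (G.vertex v) h = G.vertexGen v := by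
  have e : wire (G.ob (G.parents v) ⊗ G.vertex v) (G.vertex v) h.2.2 =
      snd (G.ob (G.parents v)) (G.vertex v) := by
    rw [← snd_comp_wire _ _ _ fun _ ha => ha, wire_self _ (List.nodup_singleton v),
      Category.comp_id]
    intro a ha
    rw [mem_vertex.1 ha]
    exact not_mem_ob_parents v
  rw [run, run, e, step, snd,
    wire_self (G.ob (G.parents v)) (Finset.sort_nodup _ _), reassoc_of% @pair_comp_tensorHom,
    Category.id_comp, Category.id_comp, Category.comp_id, pair_discard_left]

theorem isPreimageFunctor_id (G : ODAG.{u}) :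
    IsPreimageFunctor (𝟙 G) (CDFunctor.id (FreeCD G.signature)) where
  obj_eq X := (pullObj_id X).symm
  map_gen v := by
    have hr : Runnable (G.ob (G.parents v)) [v] (G.vertex v) :=
      ⟨fun _ ha => ha, not_mem_ob_parents v, fun _ ha => List.mem_append_right _ ha⟩
    change G.vertexGen v = _
    rw [pullGen_eq_run, run_congr (pullObj_id _) (by rw [preimage_id, Finset.sort_singleton])
      (by rw [← pullObj_vertex, pullObj_id]) _ hr, run_singleton]
    refine Eq.trans ?_ (conj_eqToHom_eq (G.vertexGen v) rfl _ rfl _ _ _)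
    exact ((Category.id_comp _).trans (Category.comp_id _)).symm

/-- The contravariant functor from ordered DAGs to CD-categories given by syntax categories. -/
noncomputable def cdSynFunctor : ODAG.{u}ᵒᵖ ⥤ CDCat.{u, u} where
  obj G := G.unop.cdSyn
  map α := pullback α.unop
  map_id G := (isPreimageFunctor_pullback _).eq (isPreimageFunctor_id G.unop)
  map_comp α β := (isPreimageFunctor_pullback _).eq (isPreimageFunctor_comp β.unop α.unop)

end ODAG

theorem theorem3p2 :
    ∃ (F : ODAG.{u}ᵒᵖ ⥤ CDCat.{u, u}) (hF : ∀ G : ODAG.{u}, F.obj (op G) = G.cdSyn),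
      ∀ (G G' : ODAG.{u}) (α : G ⟶ G'),
        ODAG.IsPreimageFunctor α
          (eqToHom (hF G').symm ≫ F.map α.op ≫ eqToHom (hF G) : G'.cdSyn ⟶ G.cdSyn) ∧
        ∀ Φ : G'.cdSyn ⟶ G.cdSyn, ODAG.IsPreimageFunctor α Φ →
          Φ = eqToHom (hF G').symm ≫ F.map α.op ≫ eqToHom (hF G) := by
  refine ⟨ODAG.cdSynFunctor, fun _ => rfl, fun G G' α => ?_⟩
  -- The object equalities hold by definition, so the transports in the statement are identities.
  have e : eqToHom (rfl : G'.cdSyn = ODAG.cdSynFunctor.obj (op G')) ≫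
      ODAG.cdSynFunctor.map α.op ≫ eqToHom (rfl : ODAG.cdSynFunctor.obj (op G) = G.cdSyn) =
      ODAG.pullback α := (Category.id_comp _).trans (Category.comp_id _)
  refine ⟨?_, fun Φ hΦ => ?_⟩
  · exact e.symm ▸ ODAG.isPreimageFunctor_pullback α
  · exact (hΦ.eq (ODAG.isPreimageFunctor_pullback α)).trans e.symm
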